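/- Let $\Lambda\subset\mathbb{C}$ be a finite nonempty set, let $c_\lambda\neq 0$ be complex numbers for $\lambda\in\Lambda$, and let $$f(z)=\sum_{\lambda\in\Lambda}c_\lambda e^{\bar\lambda z},\qquad z\in\mathbb{C},$$ be the corresponding exponential sum. Let its Newton polygon $\Delta$ be the convex hull of $\Lambda$, and let $l(f)$ be the semiperimeter of $\Delta$, i.e. half the sum of the lengths of its sides; if $\Delta$ is a segment, $l(f)$ is the length of this segment (and $l(f)=0$ if $\Delta$ is a point). For $r\ge 0$ let $N(f,r)$ be the number of zeros of $f$, counted with multiplicities, in the disk $\{z\in\mathbb{C}:|z|\le r\}$. Then $N(f,r)$ is finite for every $r$, and $$N(f,r)=\frac{r}{\pi}\,l(f)+O(1),$$ i.e. there is a constant $C$, depending only on $f$, such that $\left|N(f,r)-\frac{r}{\pi}\,l(f)\right|\le C$ for all $r\ge 0$. -/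

import Mathlib

namespace ExponentialSum

/-- The exponential sum `∑ a ∈ Λ, c a * exp (conj a * z)` with spectrum `Λ` and coefficients `c`. -/
noncomputable def expSum (Λ : Finset ℂ) (c : ℂ → ℂ) (z : ℂ) : ℂ :=
  ∑ a ∈ Λ, c a * Complex.exp ((starRingEnd ℂ) a * z)

/-- The Newton polygon: the convex hull of the spectrum. -/
def newtonPolygon (Λ : Finset ℂ) : Set ℂ :=
  convexHull ℝ (Λ : Set ℂ)

/-- The face of `Δ` with outward normal `u`: the points of `Δ` at which the real linear function
`x ↦ Re (conj u * x)` attains its maximum over `Δ`. -/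
def face (Δ : Set ℂ) (u : ℂ) : Set ℂ :=
  {x | x ∈ Δ ∧ ∀ y ∈ Δ, inner ℝ u y ≤ inner ℝ u x}

/-- Half the sum of the lengths of the sides of the convex polygon `Δ`. The sides are the faces
of positive length, one for each outward unit normal `u` (for every other unit vector `u` the face
is a vertex and contributes `0`). A segment is the face for both of its unit normals, so its
perimeter is twice its length, and its semiperimeter is its length. -/
noncomputable def semiperimeter (Δ : Set ℂ) : ℝ :=
  (∑ᶠ u ∈ Metric.sphere (0 : ℂ) 1, Metric.diam (face Δ u)) / 2

/-- The number of zeros of `f` in the closed disk of radius `r` centered at the origin, counted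
with multiplicities. -/
noncomputable def zeroCount (f : ℂ → ℂ) (r : ℝ) : ℕ :=
  ∑ᶠ z ∈ Metric.closedBall (0 : ℂ) r, analyticOrderNatAt f z

/-- Faces of positive length contain two distinct points of the spectrum. -/
theorem exists_pair_of_diam_face_ne_zero (Λ : Finset ℂ) (u : ℂ)
    (h : Metric.diam (face (newtonPolygon Λ) u) ≠ 0) :
    ∃ a ∈ Λ, ∃ b ∈ Λ, a ≠ b ∧ inner ℝ u a = inner ℝ u b := by
  by_contra! hno
  apply h
  apply Metric.diam_subsingleton
  intro x hx y hy
  obtain ⟨hxΔ, hxm⟩ := hx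
  obtain ⟨hyΔ, hym⟩ := hy
  -- every maximum point is equal to any spectrum point of maximal value
  have key : ∀ x ∈ newtonPolygon Λ, (∀ y ∈ newtonPolygon Λ, inner ℝ u y ≤ inner ℝ u x) →
      ∀ p ∈ Λ, inner ℝ u x ≤ inner ℝ u p → x = p := by
    intro x hx hm p hp hxp
    have hsub : ∀ a ∈ Λ, a ∈ newtonPolygon Λ := fun a ha =>
      subset_convexHull ℝ _ (Finset.mem_coe.2 ha)
    obtain ⟨w, hw0, hw1, hwx⟩ := Finset.mem_convexHull'.1 hx
    have hin : inner ℝ u x = ∑ a ∈ Λ, w a * inner ℝ u a := by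
      rw [← hwx, inner_sum]
      simp only [inner_smul_right]
    have hz : ∑ a ∈ Λ, w a * (inner ℝ u x - inner ℝ u a) = 0 := by
      simp only [mul_sub, Finset.sum_sub_distrib, ← Finset.sum_mul, hw1, one_mul]
      rw [← hin, sub_self]
    have hz' := (Finset.sum_eq_zero_iff_of_nonneg (fun a ha =>
      mul_nonneg (hw0 a ha) (sub_nonneg.2 (hm a (hsub a ha))))).1 hz
    have hwz : ∀ a ∈ Λ, a ≠ p → w a = 0 := by
      intro a ha hap
      rcases mul_eq_zero.1 (hz' a ha) with h0 | h0
      · exact h0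
      · refine absurd ?_ (hno a ha p hp hap)
        linarith [hm p (hsub p hp)]
    have h1 : w p = 1 := by
      rw [← hw1]
      exact (Finset.sum_eq_single_of_mem p hp hwz).symm
    rw [← hwx, Finset.sum_eq_single_of_mem p hp
      (fun a ha hap => by rw [hwz a ha hap, zero_smul]), h1, one_smul]
  have hne : Λ.Nonempty := by
    rcases Λ.eq_empty_or_nonempty with h0 | h0
    · simp [newtonPolygon, h0] at hxΔ
    · exact h0
  obtain ⟨p, hp, hpm⟩ := Λ.exists_max_image (fun a => (inner ℝ u a : ℝ)) hne
  have hle : ∀ x ∈ newtonPolygon Λ, inner ℝ u x ≤ inner ℝ u p := by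
    intro x hx
    obtain ⟨w, hw0, hw1, hwx⟩ := Finset.mem_convexHull'.1 hx
    rw [← hwx, inner_sum]
    simp only [inner_smul_right]
    calc ∑ a ∈ Λ, w a * inner ℝ u a ≤ ∑ a ∈ Λ, w a * inner ℝ u p :=
          Finset.sum_le_sum fun a ha => mul_le_mul_of_nonneg_left (hpm a ha) (hw0 a ha)
      _ = inner ℝ u p := by rw [← Finset.sum_mul, hw1, one_mul]
  rw [key x hxΔ hxm p hp (hle x hxΔ), key y hyΔ hym p hp (hle y hyΔ)]

/-- A Newton polygon has finitely many sides, so that the sum defining its semiperimeter is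
a finite sum. -/
theorem finite_sides (Λ : Finset ℂ) :
    {u | u ∈ Metric.sphere (0 : ℂ) 1 ∧
      Metric.diam (face (newtonPolygon Λ) u) ≠ 0}.Finite := by
  have hfin : (⋃ q ∈ (Λ ×ˢ Λ).filter (fun q => q.1 ≠ q.2),
      ({Complex.I * (q.1 - q.2) / (‖q.1 - q.2‖ : ℂ),
        -(Complex.I * (q.1 - q.2) / (‖q.1 - q.2‖ : ℂ))} : Set ℂ)).Finite :=
    Set.Finite.biUnion (Finset.finite_toSet _) fun q _ => Set.toFinite _
  refine hfin.subset ?_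
  rintro u ⟨hu, hd⟩
  obtain ⟨a, ha, b, hb, hab, he⟩ := exists_pair_of_diam_face_ne_zero Λ u hd
  simp only [Set.mem_iUnion]
  refine ⟨(a, b), by simp [ha, hb, hab], ?_⟩
  have hn : (‖a - b‖ : ℂ) ≠ 0 := by
    simpa [sub_eq_zero] using hab
  have hu1 : u.re * u.re + u.im * u.im = 1 := by
    have h1 : ‖u‖ = 1 := by simpa using hu
    have h2 := Complex.normSq_eq_norm_sq u
    rw [h1, Complex.normSq_apply] at h2
    simpa using h2
  have hd2 : (‖a - b‖ : ℂ) * (‖a - b‖ : ℂ) =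
      (((a - b).re * (a - b).re + (a - b).im * (a - b).im : ℝ) : ℂ) := by
    rw [← Complex.normSq_apply, Complex.normSq_eq_norm_sq]
    push_cast
    ring
  have ho : u.re * (a - b).re + u.im * (a - b).im = 0 := by
    have h0 : inner ℝ u (a - b) = (0 : ℝ) := by rw [inner_sub_right, he, sub_self]
    rw [Complex.inner] at h0
    have h1 : (a - b).re * u.re + (a - b).im * u.im = 0 := by simpa using h0
    linarith
  have hsq : (u * (‖a - b‖ : ℂ)) ^ 2 = (Complex.I * (a - b)) ^ 2 := by
    rw [mul_pow, pow_two (‖a - b‖ : ℂ), hd2]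
    generalize a - b = d at ho ⊢
    apply Complex.ext
    · simp [pow_two]
      linear_combination (2 * u.re * d.re - 2 * u.im * d.im) * ho - (d.re ^ 2 - d.im ^ 2) * hu1
    · simp [pow_two]
      linear_combination (2 * u.re * d.im + 2 * u.im * d.re) * ho - (2 * d.re * d.im) * hu1
  simp only [Set.mem_insert_iff, Set.mem_singleton_iff]
  rcases sq_eq_sq_iff_eq_or_eq_neg.1 hsq with h1 | h1
  · left
    rw [eq_div_iff hn, h1]
  · right
    rw [← neg_div, eq_div_iff hn, h1]

end ExponentialSum

/-!
Put `S z = ∑ ‖c a‖ exp (re (conj a * z))`, so that `‖f‖ ≤ S`. Along each ray `log S` is linear, with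
slope the support function of the Newton polygon, up to an error which is exponentially small away
from the normals to the differences `a - b`. By Cauchy's formula for the perimeter, the circle
average of `log S` therefore grows like `r * l(f) / π`. The deficit `log (S / ‖f‖)` is small
away from the same normals, and Cartan-type mean value estimates bound its integral over annuli of
width one, so that in each of these some circle of radius `t` carries an average deficit `O(1 / t)`.
Jensen's formula compares the zero count at such a radius with the increments of the average of
`log S` over `[t, t + 1]` and `[t - 1, t]`, and monotonicity of the zero count does the rest.
-/

namespace ExponentialSum

open Real MeasureTheory Metric Set Filter Topology
open scoped InnerProductSpace ComplexConjugate

section Sums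

theorem exists_norm_le_mul_norm {ι F : Type*} [NormedAddCommGroup F] {s : Finset ι} {c : ι → F}
    (hc : ∀ a ∈ s, c a ≠ 0) : ∃ C > 0, ∀ a ∈ s, ∀ b ∈ s, ‖c b‖ ≤ C * ‖c a‖ := by
  obtain ⟨C, hC⟩ := ((s ×ˢ s).image fun p => ‖c p.2‖ / ‖c p.1‖).exists_le
  refine ⟨max C 1, by positivity, fun a ha b hb => ?_⟩
  rw [← div_le_iff₀ (norm_pos_iff.2 (hc a ha))]
  exact (hC _ (Finset.mem_image_of_mem _ (Finset.mk_mem_product ha hb))).trans (le_max_left _ _)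

theorem sum_mul_exp_le {ι : Type*} {s : Finset ι} {w φ ψ : ι → ℝ} {δ : ℝ}
    (hw : ∀ i ∈ s, 0 ≤ w i) (h : ∀ i ∈ s, φ i ≤ ψ i + δ) :
    ∑ i ∈ s, w i * exp (φ i) ≤ (∑ i ∈ s, w i * exp (ψ i)) * exp δ := by
  rw [Finset.sum_mul]
  refine Finset.sum_le_sum fun i hi => ?_
  rw [mul_assoc, ← exp_add]
  exact mul_le_mul_of_nonneg_left (exp_le_exp.2 (h i hi)) (hw i hi)

end Sums

section InnerProductSpace

variable {E : Type*} [NormedAddCommGroup E] [InnerProductSpace ℝ E] {Λ : Finset E} {c : E → ℂ}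

/-- The support function `u ↦ max {⟪u, a⟫ | a ∈ Λ}` of a finite set, with value `0` for `Λ = ∅`. -/
noncomputable def supportFun (Λ : Finset E) (u : E) : ℝ :=
  sSup ((fun a => ⟪u, a⟫_ℝ) '' Λ)

open scoped Classical in
/-- The points of `Λ` lying on the supporting hyperplane with outward normal `u`. -/
noncomputable def maxFace (Λ : Finset E) (u : E) : Finset E :=
  {a ∈ Λ | ∀ b ∈ Λ, ⟪u, b⟫_ℝ ≤ ⟪u, a⟫_ℝ}

/-- The sum of the absolute values of the terms `c a * exp ⟪z, a⟫` of an exponential sum. -/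
noncomputable def absSum (Λ : Finset E) (c : E → ℂ) (z : E) : ℝ :=
  ∑ a ∈ Λ, ‖c a‖ * exp ⟪z, a⟫_ℝ

open scoped Classical in
/-- A gauge of how far one term dominates an exponential sum with spectrum `Λ` at `z`: it is small
exactly where any two of the exponentials `exp ⟪z, a⟫` have very different sizes. -/
noncomputable def pairSum (Λ : Finset E) (z : E) : ℝ :=
  ∑ p ∈ Λ.offDiag, exp (-|⟪z, p.1 - p.2⟫_ℝ|)

theorem mem_maxFace {u a : E} : a ∈ maxFace Λ u ↔ a ∈ Λ ∧ ∀ b ∈ Λ, ⟪u, b⟫_ℝ ≤ ⟪u, a⟫_ℝ := by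
  classical exact Finset.mem_filter

theorem maxFace_nonempty (hΛ : Λ.Nonempty) (u : E) : (maxFace Λ u).Nonempty :=
  let ⟨a, ha, hmax⟩ := Λ.exists_max_image (fun a => ⟪u, a⟫_ℝ) hΛ
  ⟨a, mem_maxFace.2 ⟨ha, hmax⟩⟩

theorem inner_le_supportFun {a : E} (ha : a ∈ Λ) (u : E) : ⟪u, a⟫_ℝ ≤ supportFun Λ u :=
  le_csSup (Λ.finite_toSet.image _).bddAbove (mem_image_of_mem _ ha)

theorem supportFun_eq_inner {a u : E} (ha : a ∈ maxFace Λ u) : supportFun Λ u = ⟪u, a⟫_ℝ := by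
  obtain ⟨haΛ, hmax⟩ := mem_maxFace.1 ha
  exact le_antisymm (csSup_le ⟨_, mem_image_of_mem _ haΛ⟩ (forall_mem_image.2 hmax))
    (inner_le_supportFun haΛ u)

theorem supportFun_singleton (a u : E) : supportFun {a} u = ⟪u, a⟫_ℝ := by
  simp [supportFun]

theorem continuous_supportFun (Λ : Finset E) : Continuous (supportFun Λ) := by
  rcases Λ.eq_empty_or_nonempty with rfl | hΛ
  · have hzero : supportFun (∅ : Finset E) = fun _ => 0 := funext fun u => by simp [supportFun]
    exact hzero ▸ continuous_const
  · have hsup : supportFun Λ = fun u => Λ.sup' hΛ fun a => ⟪u, a⟫_ℝ :=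
      funext fun u => (Finset.sup'_eq_csSup_image Λ hΛ _).symm
    rw [hsup]
    exact Continuous.finset_sup'_apply hΛ fun a _ => by fun_prop

theorem continuous_absSum (Λ : Finset E) (c : E → ℂ) : Continuous (absSum Λ c) := by
  unfold absSum
  fun_prop

theorem continuous_pairSum (Λ : Finset E) : Continuous (pairSum Λ) := by
  unfold pairSum
  fun_prop

theorem pairSum_nonneg (Λ : Finset E) (z : E) : 0 ≤ pairSum Λ z :=
  Finset.sum_nonneg fun _ _ => (exp_pos _).le

theorem absSum_pos (hΛ : Λ.Nonempty) (hc : ∀ a ∈ Λ, c a ≠ 0) (z : E) : 0 < absSum Λ c z :=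
  Finset.sum_pos (fun a ha => mul_pos (norm_pos_iff.2 (hc a ha)) (exp_pos _)) hΛ

theorem exists_absSum_le_mul_exp_norm_sub (Λ : Finset E) (c : E → ℂ) :
    ∃ L ≥ 0, ∀ z w, absSum Λ c w ≤ absSum Λ c z * exp (L * ‖w - z‖) := by
  refine ⟨∑ a ∈ Λ, ‖a‖, by positivity, fun z w =>
    sum_mul_exp_le (fun a _ => norm_nonneg _) fun a ha => ?_⟩
  have hle : ‖a‖ ≤ ∑ a ∈ Λ, ‖a‖ := Finset.single_le_sum (fun a _ => norm_nonneg a) ha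
  calc ⟪w, a⟫_ℝ = ⟪z, a⟫_ℝ + ⟪w - z, a⟫_ℝ := by rw [← inner_add_left, add_sub_cancel]
    _ ≤ ⟪z, a⟫_ℝ + ‖a‖ * ‖w - z‖ := by
      rw [mul_comm]
      gcongr
      exact real_inner_le_norm _ _
    _ ≤ ⟪z, a⟫_ℝ + (∑ a ∈ Λ, ‖a‖) * ‖w - z‖ := by gcongr

theorem exists_pairSum_le_mul_exp_norm_sub (Λ : Finset E) :
    ∃ L ≥ 0, ∀ z w, pairSum Λ w ≤ pairSum Λ z * exp (L * ‖w - z‖) := by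
  classical
  refine ⟨∑ p ∈ Λ.offDiag, ‖p.1 - p.2‖, by positivity, fun z w => ?_⟩
  have hexp : ∀ p ∈ Λ.offDiag, -|⟪w, p.1 - p.2⟫_ℝ| ≤
      -|⟪z, p.1 - p.2⟫_ℝ| + (∑ p ∈ Λ.offDiag, ‖p.1 - p.2‖) * ‖w - z‖ := by
    intro p hp
    have hle : ‖p.1 - p.2‖ ≤ ∑ p ∈ Λ.offDiag, ‖p.1 - p.2‖ :=
      Finset.single_le_sum (f := fun p : E × E => ‖p.1 - p.2‖) (fun p _ => norm_nonneg _) hp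
    have hdiff : |⟪z, p.1 - p.2⟫_ℝ| - |⟪w, p.1 - p.2⟫_ℝ| ≤ ‖p.1 - p.2‖ * ‖w - z‖ :=
      calc _ ≤ |⟪z, p.1 - p.2⟫_ℝ - ⟪w, p.1 - p.2⟫_ℝ| := abs_sub_abs_le_abs_sub _ _
        _ ≤ ‖z - w‖ * ‖p.1 - p.2‖ := by
          rw [← inner_sub_left]
          exact abs_real_inner_le_norm _ _
        _ = ‖p.1 - p.2‖ * ‖w - z‖ := by rw [norm_sub_rev, mul_comm]
    have := mul_le_mul_of_nonneg_right hle (norm_nonneg (w - z))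
    linarith
  simpa only [one_mul, pairSum] using sum_mul_exp_le (fun _ _ => zero_le_one) hexp

theorem exists_absSum_le_of_mem_maxFace (hc : ∀ a ∈ Λ, c a ≠ 0) :
    ∃ C > 0, ∀ z, ∀ a ∈ maxFace Λ z,
      absSum Λ c z ≤ (1 + C * pairSum Λ z) * (‖c a‖ * exp ⟪z, a⟫_ℝ) := by
  classical
  obtain ⟨C, hC, hnorm⟩ := exists_norm_le_mul_norm hc
  refine ⟨C, hC, fun z a haz => ?_⟩
  obtain ⟨ha, hmax⟩ := mem_maxFace.1 haz
  have hpair : ∑ b ∈ Λ.erase a, exp (-|⟪z, a - b⟫_ℝ|) ≤ pairSum Λ z := by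
    refine (Finset.sum_map (Λ.erase a) ⟨fun b => (a, b), Prod.mk_right_injective a⟩
      fun p : E × E => exp (-|⟪z, p.1 - p.2⟫_ℝ|)).symm.trans_le
        (Finset.sum_le_sum_of_subset_of_nonneg ?_ fun _ _ _ => (exp_pos _).le)
    intro p hp
    obtain ⟨b, hb, rfl⟩ := Finset.mem_map.1 hp
    obtain ⟨hba, hbΛ⟩ := Finset.mem_erase.1 hb
    exact Finset.mem_offDiag.2 ⟨ha, hbΛ, hba.symm⟩
  have hterm : ∀ b ∈ Λ.erase a, ‖c b‖ * exp ⟪z, b⟫_ℝ ≤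
      exp (-|⟪z, a - b⟫_ℝ|) * (C * ‖c a‖ * exp ⟪z, a⟫_ℝ) := by
    intro b hb
    have hbΛ := Finset.mem_of_mem_erase hb
    have hexp : exp ⟪z, b⟫_ℝ = exp (-|⟪z, a - b⟫_ℝ|) * exp ⟪z, a⟫_ℝ := by
      rw [inner_sub_right, abs_of_nonneg (sub_nonneg.2 (hmax b hbΛ)), ← exp_add]
      congr 1
      ring
    rw [hexp, mul_left_comm]
    gcongr
    exact hnorm a ha b hbΛ
  calc absSum Λ c z = ‖c a‖ * exp ⟪z, a⟫_ℝ + ∑ b ∈ Λ.erase a, ‖c b‖ * exp ⟪z, b⟫_ℝ :=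
        (Finset.add_sum_erase _ _ ha).symm
    _ ≤ ‖c a‖ * exp ⟪z, a⟫_ℝ + pairSum Λ z * (C * ‖c a‖ * exp ⟪z, a⟫_ℝ) := by
        refine add_le_add_right ((Finset.sum_le_sum hterm).trans ?_) _
        rw [← Finset.sum_mul]
        gcongr
    _ = (1 + C * pairSum Λ z) * (‖c a‖ * exp ⟪z, a⟫_ℝ) := by ring

theorem log_absSum_smul_le (hΛ : Λ.Nonempty) (hc : ∀ a ∈ Λ, c a ≠ 0) {s t : ℝ} (hst : s ≤ t)
    (u : E) :
    log (absSum Λ c (t • u)) ≤ log (absSum Λ c (s • u)) + (t - s) * supportFun Λ u := by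
  have hle : absSum Λ c (t • u) ≤
      absSum Λ c (s • u) * exp ((t - s) * supportFun Λ u) := by
    refine sum_mul_exp_le (fun a _ => norm_nonneg _) fun a ha => ?_
    have := mul_le_mul_of_nonneg_left (inner_le_supportFun ha u) (sub_nonneg.2 hst)
    rw [real_inner_smul_left, real_inner_smul_left]
    linarith
  have hlog := log_le_log (absSum_pos hΛ hc _) hle
  rwa [log_mul (absSum_pos hΛ hc _).ne' (exp_ne_zero _), log_exp] at hlog

theorem exists_le_log_absSum_smul (hΛ : Λ.Nonempty) (hc : ∀ a ∈ Λ, c a ≠ 0) :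
    ∃ C > 0, ∀ (u : E) (s t : ℝ), 0 ≤ s → log (absSum Λ c (s • u)) + (t - s) * supportFun Λ u ≤
      log (absSum Λ c (t • u)) + C * pairSum Λ (s • u) := by
  obtain ⟨C, hC, hdom⟩ := exists_absSum_le_of_mem_maxFace hc
  refine ⟨C, hC, fun u s t hs => ?_⟩
  obtain ⟨a, ha⟩ := maxFace_nonempty hΛ u
  obtain ⟨haΛ, hmax⟩ := mem_maxFace.1 ha
  have has : a ∈ maxFace Λ (s • u) := by
    simp only [mem_maxFace, real_inner_smul_left]
    exact ⟨haΛ, fun b hb => mul_le_mul_of_nonneg_left (hmax b hb) hs⟩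
  have hca := norm_pos_iff.2 (hc a haΛ)
  have hq : 0 ≤ C * pairSum Λ (s • u) := mul_nonneg hC.le (pairSum_nonneg _ _)
  have hupper : log (absSum Λ c (s • u)) ≤
      C * pairSum Λ (s • u) + (log ‖c a‖ + s * ⟪u, a⟫_ℝ) := by
    refine (log_le_log (absSum_pos hΛ hc _) (hdom _ a has)).trans ?_
    rw [log_mul (by positivity) (by positivity), log_mul hca.ne' (exp_ne_zero _), log_exp,
      real_inner_smul_left]
    have := log_le_sub_one_of_pos (x := 1 + C * pairSum Λ (s • u)) (by positivity)
    linarith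
  have hlower : log ‖c a‖ + t * ⟪u, a⟫_ℝ ≤ log (absSum Λ c (t • u)) := by
    rw [← real_inner_smul_left, ← log_exp ⟪t • u, a⟫_ℝ, ← log_mul hca.ne' (exp_ne_zero _)]
    exact log_le_log (by positivity) (Finset.single_le_sum
      (f := fun b => ‖c b‖ * exp ⟪t • u, b⟫_ℝ) (fun b _ => by positivity) haΛ)
  rw [supportFun_eq_inner ha]
  linarith

theorem exists_norm_sub_le_forall_le_abs_inner {ι : Type*} {s : Finset ι} {d : ι → E}
    (hd : ∀ i ∈ s, d i ≠ 0) (K : ℝ) :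
    ∃ R ≥ 0, ∀ z, ∃ w, ‖w - z‖ ≤ R ∧ ∀ i ∈ s, K ≤ |⟪w, d i⟫_ℝ| := by
  classical
  induction s using Finset.induction_on generalizing K with
  | empty => exact ⟨0, le_rfl, fun z => ⟨z, by simp⟩⟩
  | insert j s _ ih =>
    obtain ⟨hdj, hds⟩ := Finset.forall_mem_insert _ _ _ |>.1 hd
    let v : E := (2 * |K| / ‖d j‖ ^ 2) • d j
    obtain ⟨R, hR, hgood⟩ := ih hds (|K| + ∑ i ∈ s, |⟪v, d i⟫_ℝ|)
    refine ⟨R + ‖v‖, by positivity, fun z => ?_⟩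
    obtain ⟨w, hwz, hw⟩ := hgood z
    by_cases hwj : K ≤ |⟪w, d j⟫_ℝ|
    · refine ⟨w, hwz.trans (le_add_of_nonneg_right (norm_nonneg v)),
        Finset.forall_mem_insert _ _ _ |>.2 ⟨hwj, fun i hi => ?_⟩⟩
      exact (le_abs_self K).trans ((le_add_of_nonneg_right (by positivity)).trans (hw i hi))
    · refine ⟨w + v, ?_, Finset.forall_mem_insert _ _ _ |>.2 ⟨?_, fun i hi => ?_⟩⟩
      · rw [add_sub_right_comm]
        exact (norm_add_le _ _).trans (by gcongr)
      · have hv : ⟪v, d j⟫_ℝ = 2 * |K| := by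
          rw [real_inner_smul_left, real_inner_self_eq_norm_sq,
            div_mul_cancel₀ _ (pow_ne_zero 2 (norm_ne_zero_iff.2 hdj))]
        rw [inner_add_left, hv]
        refine le_trans ?_ (le_abs_self _)
        linarith [neg_abs_le ⟪w, d j⟫_ℝ, le_abs_self K]
      · have hvi : |⟪v, d i⟫_ℝ| ≤ ∑ i ∈ s, |⟪v, d i⟫_ℝ| :=
          Finset.single_le_sum (f := fun i => |⟪v, d i⟫_ℝ|) (fun i _ => abs_nonneg _) hi
        have := abs_sub_abs_le_abs_add ⟪w, d i⟫_ℝ ⟪v, d i⟫_ℝ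
        rw [inner_add_left]
        linarith [hw i hi, le_abs_self K]

theorem exists_norm_sub_le_pairSum_le (Λ : Finset E) {ε : ℝ} (hε : 0 < ε) :
    ∃ R ≥ 0, ∀ z, ∃ w, ‖w - z‖ ≤ R ∧ pairSum Λ w ≤ ε := by
  classical
  have hd : ∀ p ∈ Λ.offDiag, p.1 - p.2 ≠ 0 := fun p hp =>
    sub_ne_zero.2 (Finset.mem_offDiag.1 hp).2.2
  obtain ⟨R, hR, hgood⟩ := exists_norm_sub_le_forall_le_abs_inner hd (Λ.offDiag.card / ε)
  refine ⟨R, hR, fun z => ?_⟩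
  obtain ⟨w, hwz, hw⟩ := hgood z
  refine ⟨w, hwz, ?_⟩
  calc pairSum Λ w ≤ ∑ _p ∈ Λ.offDiag, exp (-(Λ.offDiag.card / ε)) :=
        Finset.sum_le_sum fun p hp => exp_le_exp.2 (neg_le_neg (hw p hp))
    _ = ε * (Λ.offDiag.card / ε * exp (-(Λ.offDiag.card / ε))) := by
        rw [Finset.sum_const, nsmul_eq_mul, ← mul_assoc, mul_div_cancel₀ _ hε.ne']
    _ ≤ ε * 1 := by
        refine mul_le_mul_of_nonneg_left ?_ hε.le
        rw [exp_neg, ← div_eq_mul_inv, div_le_one (exp_pos _)]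
        exact (le_add_of_nonneg_right zero_le_one).trans (add_one_le_exp _)
    _ = ε := mul_one ε

end InnerProductSpace

section Deficit

variable {Λ : Finset ℂ} {c : ℂ → ℂ}

/-- The defect of the triangle inequality for the terms of an exponential sum at `z`, on
a logarithmic scale. It takes the junk value `0` at the zeros of the sum. -/
noncomputable def deficit (Λ : Finset ℂ) (c : ℂ → ℂ) (z : ℂ) : ℝ :=
  log (absSum Λ c z / ‖expSum Λ c z‖)

theorem differentiable_expSum (Λ : Finset ℂ) (c : ℂ → ℂ) : Differentiable ℂ (expSum Λ c) := by
  unfold expSum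
  fun_prop

theorem norm_mul_cexp_conj_mul (w a z : ℂ) :
    ‖w * Complex.exp (conj a * z)‖ = ‖w‖ * exp ⟪z, a⟫_ℝ := by
  rw [norm_mul, Complex.norm_exp, real_inner_comm, Complex.inner, mul_comm z]

theorem norm_expSum_le_absSum (Λ : Finset ℂ) (c : ℂ → ℂ) (z : ℂ) :
    ‖expSum Λ c z‖ ≤ absSum Λ c z :=
  norm_sum_le_of_le _ fun a _ => (norm_mul_cexp_conj_mul (c a) a z).le

theorem two_mul_sub_absSum_le_norm_expSum {a : ℂ} (ha : a ∈ Λ) (z : ℂ) :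
    2 * (‖c a‖ * exp ⟪z, a⟫_ℝ) - absSum Λ c z ≤ ‖expSum Λ c z‖ := by
  have hrest : ‖∑ b ∈ Λ.erase a, c b * Complex.exp (conj b * z)‖ ≤
      ∑ b ∈ Λ.erase a, ‖c b‖ * exp ⟪z, b⟫_ℝ :=
    norm_sum_le_of_le _ fun b _ => (norm_mul_cexp_conj_mul (c b) b z).le
  have hsub := norm_sub_le_norm_add (c a * Complex.exp (conj a * z))
    (∑ b ∈ Λ.erase a, c b * Complex.exp (conj b * z))
  rw [Finset.add_sum_erase Λ (fun b => c b * Complex.exp (conj b * z)) ha,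
    norm_mul_cexp_conj_mul] at hsub
  rw [absSum, ← Finset.add_sum_erase _ _ ha, expSum]
  linarith

theorem deficit_nonneg (Λ : Finset ℂ) (c : ℂ → ℂ) (z : ℂ) : 0 ≤ deficit Λ c z := by
  rcases eq_or_ne (expSum Λ c z) 0 with h | h
  · simp [deficit, h]
  · exact log_nonneg ((one_le_div (norm_pos_iff.2 h)).2 (norm_expSum_le_absSum Λ c z))

theorem exists_deficit_le_pairSum (hΛ : Λ.Nonempty) (hc : ∀ a ∈ Λ, c a ≠ 0) :
    ∃ C > 0, ∀ z, C * pairSum Λ z ≤ 1 / 2 →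
      expSum Λ c z ≠ 0 ∧ deficit Λ c z ≤ 4 * (C * pairSum Λ z) := by
  obtain ⟨C, hC, hdom⟩ := exists_absSum_le_of_mem_maxFace hc
  refine ⟨C, hC, fun z hz => ?_⟩
  obtain ⟨a, ha⟩ := maxFace_nonempty hΛ z
  have haΛ := (mem_maxFace.1 ha).1
  have hT : 0 < ‖c a‖ * exp ⟪z, a⟫_ℝ := mul_pos (norm_pos_iff.2 (hc a haΛ)) (exp_pos _)
  have hq : 0 ≤ C * pairSum Λ z := mul_nonneg hC.le (pairSum_nonneg _ _)
  have hlower : (1 - C * pairSum Λ z) * (‖c a‖ * exp ⟪z, a⟫_ℝ) ≤ ‖expSum Λ c z‖ := by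
    linarith [hdom z a ha, two_mul_sub_absSum_le_norm_expSum (c := c) haΛ z]
  have hpos : 0 < ‖expSum Λ c z‖ := (mul_pos (by linarith) hT).trans_le hlower
  refine ⟨norm_pos_iff.1 hpos, ?_⟩
  refine (log_le_sub_one_of_pos (div_pos (absSum_pos hΛ hc z) hpos)).trans ?_
  rw [sub_le_iff_le_add, div_le_iff₀ hpos]
  calc absSum Λ c z ≤ (1 + C * pairSum Λ z) * (‖c a‖ * exp ⟪z, a⟫_ℝ) := hdom z a ha
    _ ≤ (4 * (C * pairSum Λ z) + 1) * (1 - C * pairSum Λ z) * (‖c a‖ * exp ⟪z, a⟫_ℝ) := by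
        gcongr
        nlinarith
    _ ≤ (4 * (C * pairSum Λ z) + 1) * ‖expSum Λ c z‖ := by
        rw [mul_assoc]
        gcongr

end Deficit

section CircleAverage

theorem integral_exp_neg_mul_le {k : ℝ} (hk : 0 < k) (b : ℝ) :
    ∫ x in (0 : ℝ)..b, exp (-(k * x)) ≤ 1 / k := by
  have hderiv : ∀ x ∈ uIcc 0 b, HasDerivAt (fun x => -(1 / k) * exp (-(k * x)))
      (exp (-(k * x))) x := fun x _ => by
    convert! (((hasDerivAt_id x).const_mul k).neg.exp.const_mul (-(1 / k))) using 1
    simp only [one_div, id_eq, Pi.neg_apply, mul_one, mul_neg, neg_mul, neg_neg]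
    field_simp
  rw [intervalIntegral.integral_eq_sub_of_hasDerivAt hderiv
    (Continuous.intervalIntegrable (by fun_prop) _ _), mul_zero, neg_zero, exp_zero]
  have : 0 < 1 / k * exp (-(k * b)) := by positivity
  linarith

theorem exp_neg_mul_abs_sin_le {s x : ℝ} (hs : 0 < s) (hx : x ∈ Icc 0 π) :
    exp (-(s * |sin x|)) ≤ exp (-(2 * s / π * x)) + exp (-(2 * s / π * (π - x))) := by
  rw [abs_of_nonneg (sin_nonneg_of_mem_Icc hx)]
  rcases le_total x (π / 2) with h | h
  · refine le_add_of_le_of_nonneg (exp_le_exp.2 (neg_le_neg ?_)) (exp_pos _).le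
    calc 2 * s / π * x = s * (2 / π * x) := by ring
      _ ≤ s * sin x := by gcongr; exact mul_le_sin hx.1 h
  · refine le_add_of_nonneg_of_le (exp_pos _).le (exp_le_exp.2 (neg_le_neg ?_))
    calc 2 * s / π * (π - x) = s * (2 / π * (π - x)) := by ring
      _ ≤ s * sin x := by
        rw [← sin_pi_sub]
        gcongr
        exact mul_le_sin (sub_nonneg.2 hx.2) (by linarith)

theorem integral_exp_neg_mul_abs_sin_le {s : ℝ} (hs : 0 < s) :
    ∫ x in (0 : ℝ)..(2 * π), exp (-(s * |sin x|)) ≤ 2 * π / s := by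
  have hcont : Continuous fun x : ℝ => exp (-(s * |sin x|)) := by fun_prop
  have hper : Function.Periodic (fun x : ℝ => exp (-(s * |sin x|))) π := fun x => by
    simp only [sin_add_pi, abs_neg]
  have hhalf : ∫ x in (0 : ℝ)..π, exp (-(s * |sin x|)) ≤ π / s := by
    calc ∫ x in (0 : ℝ)..π, exp (-(s * |sin x|))
        ≤ ∫ x in (0 : ℝ)..π, (exp (-(2 * s / π * x)) + exp (-(2 * s / π * (π - x)))) :=
          intervalIntegral.integral_mono_on pi_pos.le (hcont.intervalIntegrable _ _)
            (Continuous.intervalIntegrable (by fun_prop) _ _) fun x hx =>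
              exp_neg_mul_abs_sin_le hs hx
      _ = 2 * ∫ x in (0 : ℝ)..π, exp (-(2 * s / π * x)) := by
          rw [intervalIntegral.integral_add (Continuous.intervalIntegrable (by fun_prop) _ _)
              (Continuous.intervalIntegrable (by fun_prop) _ _),
            intervalIntegral.integral_comp_sub_left (fun x => exp (-(2 * s / π * x))),
            sub_self, sub_zero]
          ring
      _ ≤ 2 * (1 / (2 * s / π)) := by gcongr; exact integral_exp_neg_mul_le (by positivity) π
      _ = π / s := by field_simp
  have hshift := hper.intervalIntegral_add_eq π 0
  rw [zero_add, ← two_mul] at hshift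
  calc ∫ x in (0 : ℝ)..(2 * π), exp (-(s * |sin x|))
      = 2 * ∫ x in (0 : ℝ)..π, exp (-(s * |sin x|)) := by
        rw [← intervalIntegral.integral_add_adjacent_intervals (hcont.intervalIntegrable 0 π)
          (hcont.intervalIntegrable π _), hshift, two_mul]
    _ ≤ 2 * π / s := by rw [mul_div_assoc]; gcongr

theorem inner_circleMap_zero (t θ : ℝ) (d : ℂ) :
    ⟪circleMap 0 t θ, d⟫_ℝ = t * ‖d‖ * cos (θ - d.arg) := by
  have hre : d.re = ‖d‖ * cos d.arg := (Complex.norm_mul_cos_arg d).symm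
  have him : d.im = ‖d‖ * sin d.arg := (Complex.norm_mul_sin_arg d).symm
  rw [Complex.inner, cos_sub]
  simp only [circleMap_zero, Complex.mul_re, Complex.conj_re, Complex.conj_im,
    Complex.mul_im, Complex.ofReal_re, Complex.ofReal_im, Complex.exp_ofReal_mul_I_re,
    Complex.exp_ofReal_mul_I_im]
  rw [hre, him]
  ring

theorem circleAverage_exp_neg_abs_inner_le {d : ℂ} (hd : d ≠ 0) {t : ℝ} (ht : 0 < t) :
    circleAverage (fun z => exp (-|⟪z, d⟫_ℝ|)) 0 t ≤ ‖d‖⁻¹ / t := by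
  have htd : 0 < t * ‖d‖ := mul_pos ht (norm_pos_iff.2 hd)
  have hsin : ∀ θ, |⟪circleMap 0 t (θ + (d.arg + π / 2)), d⟫_ℝ| = t * ‖d‖ * |sin θ| := fun θ => by
    rw [inner_circleMap_zero, abs_mul, abs_of_pos htd, add_sub_assoc, add_sub_cancel_left,
      cos_add_pi_div_two, abs_neg]
  rw [circleAverage_eq_integral_add (d.arg + π / 2), smul_eq_mul]
  simp only [hsin]
  calc (2 * π)⁻¹ * ∫ θ in (0 : ℝ)..(2 * π), exp (-(t * ‖d‖ * |sin θ|))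
      ≤ (2 * π)⁻¹ * (2 * π / (t * ‖d‖)) := by gcongr; exact integral_exp_neg_mul_abs_sin_le htd
    _ = ‖d‖⁻¹ / t := by field_simp

theorem exists_circleAverage_pairSum_le (Λ : Finset ℂ) :
    ∃ C ≥ 0, ∀ t > 0, circleAverage (pairSum Λ) 0 t ≤ C / t := by
  classical
  refine ⟨∑ p ∈ Λ.offDiag, ‖p.1 - p.2‖⁻¹, by positivity, fun t ht => ?_⟩
  have hsum : pairSum Λ = ∑ p ∈ Λ.offDiag, fun z => exp (-|⟪z, p.1 - p.2⟫_ℝ|) := by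
    ext z
    simp only [pairSum, Finset.sum_apply]
  rw [hsum, circleAverage_sum fun p _ =>
    (Continuous.continuousOn (by fun_prop)).circleIntegrable', Finset.sum_div]
  exact Finset.sum_le_sum fun p hp => circleAverage_exp_neg_abs_inner_le
    (sub_ne_zero.2 (Finset.mem_offDiag.1 hp).2.2) ht

theorem log_norm_le_circleAverage {f : ℂ → ℂ} {c : ℂ} {R : ℝ}
    (hf : AnalyticOnNhd ℂ f (closedBall c |R|)) (hc : f c ≠ 0) (hR : R ≠ 0) :
    log ‖f c‖ ≤ circleAverage (fun z => log ‖f z‖) c R := by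
  rw [hf.circleAverage_log_norm hR hc]
  refine le_add_of_nonneg_left (finsum_nonneg fun u => ?_)
  by_cases hu : u ∈ closedBall c |R|
  · refine mul_nonneg (mod_cast (MeromorphicOn.AnalyticOnNhd.divisor_nonneg hf) u) ?_
    rcases eq_or_ne u c with rfl | huc
    · simp
    · rw [← log_abs, abs_mul, abs_inv, abs_norm, norm_sub_rev]
      refine log_nonneg ?_
      rw [← div_eq_mul_inv, one_le_div (norm_pos_iff.2 (sub_ne_zero.2 huc))]
      exact mem_closedBall_iff_norm.1 hu
  · simp [Function.locallyFinsuppWithin.apply_eq_zero_of_notMem _ hu]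

variable {f : ℂ → ℂ} {F : ℂ → ℝ}

theorem log_div_norm_eventuallyEq_codiscreteWithin (hf : Differentiable ℂ f) (hf0 : f ≠ 0)
    (hF0 : ∀ z, 0 < F z) (s : Set ℂ) :
    (fun z => log (F z) - log ‖f z‖) =ᶠ[codiscreteWithin s] fun z => log (F z / ‖f z‖) := by
  obtain ⟨w, hw⟩ := Function.ne_iff.1 hf0
  have hfa : AnalyticOnNhd ℂ f univ := fun z _ => hf.analyticAt z
  filter_upwards [Filter.codiscreteWithin_mono (subset_univ s)
    (hfa.preimage_zero_mem_codiscrete hw)] with z hz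
  exact (log_div (hF0 z).ne' (norm_ne_zero_iff.2 hz)).symm

theorem circleIntegrable_log (hF : Continuous F) (hF0 : ∀ z, 0 < F z) (c : ℂ) (R : ℝ) :
    CircleIntegrable (fun z => log (F z)) c R :=
  (hF.log fun z => (hF0 z).ne').continuousOn.circleIntegrable'

theorem circleIntegrable_log_norm (hf : Differentiable ℂ f) (c : ℂ) (R : ℝ) :
    CircleIntegrable (fun z => log ‖f z‖) c R :=
  MeromorphicOn.circleIntegrable_log_norm fun z _ => (hf.analyticAt z).meromorphicAt

theorem circleIntegrable_log_div_norm (hf : Differentiable ℂ f) (hf0 : f ≠ 0) (hF : Continuous F)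
    (hF0 : ∀ z, 0 < F z) (c : ℂ) (R : ℝ) :
    CircleIntegrable (fun z => log (F z / ‖f z‖)) c R :=
  ((circleIntegrable_log hF hF0 c R).sub (circleIntegrable_log_norm hf c R)).congr_codiscreteWithin
    (log_div_norm_eventuallyEq_codiscreteWithin hf hf0 hF0 _)

theorem circleAverage_log_div_norm (hf : Differentiable ℂ f) (hf0 : f ≠ 0) (hF : Continuous F)
    (hF0 : ∀ z, 0 < F z) (c : ℂ) {R : ℝ} (hR : R ≠ 0) :
    circleAverage (fun z => log (F z / ‖f z‖)) c R =
      circleAverage (fun z => log (F z)) c R - circleAverage (fun z => log ‖f z‖) c R := by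
  rw [← circleAverage_congr_codiscreteWithin
      (log_div_norm_eventuallyEq_codiscreteWithin hf hf0 hF0 _) hR,
    circleAverage_fun_sub (circleIntegrable_log hF hF0 c R) (circleIntegrable_log_norm hf c R)]

end CircleAverage

section AreaIntegral

theorem lintegral_eq_lintegral_circleMap {F : ℂ → ENNReal} (hF : Measurable F) (c : ℂ) :
    ∫⁻ z, F z = ∫⁻ ρ in Ioi (0 : ℝ), ENNReal.ofReal ρ *
      ∫⁻ θ in Ioc (-π) π, F (circleMap c ρ θ) := by
  have hpolar : ∀ p : ℝ × ℝ, c + Complex.polarCoord.symm p = circleMap c p.1 p.2 := fun p => by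
    rw [Complex.polarCoord_symm_apply, circleMap, Complex.exp_mul_I, Complex.ofReal_cos,
      Complex.ofReal_sin]
  have hmeas : Measurable fun p : ℝ × ℝ => circleMap c p.1 p.2 := by
    unfold circleMap
    fun_prop
  rw [← lintegral_add_left_eq_self F c, ← Complex.lintegral_comp_polarCoord_symm]
  simp only [hpolar, smul_eq_mul]
  rw [polarCoord_target, Measure.volume_eq_prod,
    setLIntegral_prod _ (Measurable.aemeasurable (by fun_prop))]
  refine lintegral_congr fun ρ => ?_
  rw [setLIntegral_congr Ioo_ae_eq_Ioc]
  have hθ : Measurable fun θ => F (circleMap c ρ θ) := hF.comp (continuous_circleMap c ρ).measurable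
  exact lintegral_const_mul (μ := volume.restrict (Ioc (-π) π)) (ENNReal.ofReal ρ) hθ

theorem lintegral_circleMap_eq_ofReal_circleAverage {F : ℂ → ℝ} {c : ℂ} {ρ : ℝ}
    (hint : CircleIntegrable F c ρ) (hF0 : ∀ z ∈ sphere c |ρ|, 0 ≤ F z) :
    ∫⁻ θ in Ioc (-π) π, ENNReal.ofReal (F (circleMap c ρ θ)) =
      ENNReal.ofReal (2 * π * circleAverage F c ρ) := by
  have hper : Function.Periodic (fun θ => F (circleMap c ρ θ)) (2 * π) := fun θ => by
    simp only [periodic_circleMap c ρ θ]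
  have hle : -π ≤ π := by linarith [pi_pos]
  have hint' : IntegrableOn (fun θ => F (circleMap c ρ θ)) (Ioc (-π) π) :=
    (intervalIntegrable_iff_integrableOn_Ioc_of_le hle).1
      (hper.intervalIntegrable₀ two_pi_pos.ne' hint _ _)
  rw [← ofReal_integral_eq_lintegral_ofReal hint'
    (Eventually.of_forall fun θ => hF0 _ (circleMap_mem_sphere' c ρ θ)),
    ← intervalIntegral.integral_of_le hle, circleAverage_def, smul_eq_mul,
    mul_inv_cancel_left₀ two_pi_pos.ne']
  have hshift := hper.intervalIntegral_add_eq (-π) 0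
  rw [zero_add, show -π + 2 * π = π by ring] at hshift
  rw [hshift]

theorem setLIntegral_dist_preimage {F : ℂ → ℝ} (hF : Measurable F) {c : ℂ} {s : Set ℝ}
    (hs : MeasurableSet s) (hF0 : ∀ z, dist z c ∈ s → 0 ≤ F z)
    (hint : ∀ ρ ∈ s, CircleIntegrable F c ρ) :
    ∫⁻ z in (dist · c) ⁻¹' s, ENNReal.ofReal (F z) =
      ∫⁻ ρ in s ∩ Ioi 0, ENNReal.ofReal (2 * π * ρ * circleAverage F c ρ) := by
  have hsc : MeasurableSet ((dist · c) ⁻¹' s) := hs.preimage (by fun_prop)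
  rw [← lintegral_indicator hsc, lintegral_eq_lintegral_circleMap (hF.ennreal_ofReal.indicator hsc)
    c, ← Measure.restrict_restrict hs, ← lintegral_indicator hs]
  refine setLIntegral_congr_fun measurableSet_Ioi fun ρ (hρ : 0 < ρ) => ?_
  have hdist : ∀ θ, dist (circleMap c ρ θ) c = ρ := fun θ => by
    rw [mem_sphere.1 (circleMap_mem_sphere c hρ.le θ)]
  by_cases hρs : ρ ∈ s
  · have hF0' : ∀ z ∈ sphere c |ρ|, 0 ≤ F z := fun z hz => hF0 z <| by
      rwa [mem_sphere.1 hz, abs_of_pos hρ]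
    simp only [indicator, mem_preimage, hdist, hρs, if_true]
    rw [lintegral_circleMap_eq_ofReal_circleAverage (hint ρ hρs) hF0', ← ENNReal.ofReal_mul hρ.le]
    ring_nf
  · simp [indicator, hdist, hρs]

end AreaIntegral

section DeficitIntegral

theorem setLIntegral_ball_log_div_norm_le {f : ℂ → ℂ} (hf : Differentiable ℂ f) {w : ℂ} {A R : ℝ}
    (hR : 0 < R) (hle : ∀ z ∈ ball w R, ‖f z‖ ≤ A) (hw : f w ≠ 0) :
    ∫⁻ z in ball w R, ENNReal.ofReal (log (A / ‖f z‖)) ≤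
      ENNReal.ofReal (2 * π * R ^ 2 * log (A / ‖f w‖)) := by
  have hf0 : f ≠ 0 := Function.ne_iff.2 ⟨w, hw⟩
  have hA : 0 < A := (norm_pos_iff.2 hw).trans_le (hle w (mem_ball_self hR))
  have hlog0 : ∀ z ∈ ball w R, 0 ≤ log (A / ‖f z‖) := fun z hz => by
    rcases (norm_nonneg (f z)).eq_or_lt with h | h
    · simp [← h]
    · exact log_nonneg ((one_le_div h).2 (hle z hz))
  have hmean : ∀ ρ ∈ Ioo 0 R, circleAverage (fun z => log (A / ‖f z‖)) w ρ ≤ log (A / ‖f w‖) := by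
    intro ρ hρ
    rw [circleAverage_log_div_norm hf hf0 continuous_const (fun _ => hA) w hρ.1.ne',
      circleAverage_const, log_div hA.ne' (norm_ne_zero_iff.2 hw)]
    linarith [log_norm_le_circleAverage (R := ρ) (fun z _ => hf.analyticAt z) hw hρ.1.ne']
  have hmeas : Measurable fun z => log (A / ‖f z‖) := by
    have := hf.continuous.measurable
    fun_prop
  calc ∫⁻ z in ball w R, ENNReal.ofReal (log (A / ‖f z‖))
      = ∫⁻ ρ in Iio R ∩ Ioi 0,
          ENNReal.ofReal (2 * π * ρ * circleAverage (fun z => log (A / ‖f z‖)) w ρ) :=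
        setLIntegral_dist_preimage hmeas measurableSet_Iio hlog0 fun ρ _ =>
          circleIntegrable_log_div_norm hf hf0 continuous_const (fun _ => hA) w ρ
    _ ≤ ∫⁻ _ in Iio R ∩ Ioi 0, ENNReal.ofReal (2 * π * R * log (A / ‖f w‖)) := by
        refine setLIntegral_mono' (measurableSet_Iio.inter measurableSet_Ioi) fun ρ hρ => ?_
        have hw0 := hlog0 w (mem_ball_self hR)
        have hρ0 : 0 < ρ := hρ.2
        have hρR : ρ ≤ R := hρ.1.le
        refine ENNReal.ofReal_le_ofReal ?_
        calc 2 * π * ρ * circleAverage (fun z => log (A / ‖f z‖)) w ρ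
            ≤ 2 * π * ρ * log (A / ‖f w‖) := by
              gcongr
              exact hmean ρ ⟨hρ.2, hρ.1⟩
          _ ≤ 2 * π * R * log (A / ‖f w‖) := by gcongr
    _ = ENNReal.ofReal (2 * π * R ^ 2 * log (A / ‖f w‖)) := by
        rw [setLIntegral_const, Iio_inter_Ioi, volume_Ioo, sub_zero, ← ENNReal.ofReal_mul' hR.le]
        ring_nf

variable {Λ : Finset ℂ} {c : ℂ → ℂ}

theorem expSum_ne_zero (hΛ : Λ.Nonempty) (hc : ∀ a ∈ Λ, c a ≠ 0) : expSum Λ c ≠ 0 := by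
  obtain ⟨C, hC, hdom⟩ := exists_deficit_le_pairSum hΛ hc
  obtain ⟨R, -, hgood⟩ := exists_norm_sub_le_pairSum_le Λ (ε := 1 / 2 / C) (by positivity)
  obtain ⟨w, -, hw⟩ := hgood 0
  exact Function.ne_iff.2 ⟨w, (hdom w ((le_div_iff₀' hC).1 hw)).1⟩

theorem measurable_deficit (Λ : Finset ℂ) (c : ℂ → ℂ) : Measurable (deficit Λ c) := by
  have := (continuous_absSum Λ c).measurable
  have := (differentiable_expSum Λ c).continuous.measurable
  unfold deficit
  fun_prop

theorem circleIntegrable_deficit (hΛ : Λ.Nonempty) (hc : ∀ a ∈ Λ, c a ≠ 0) (z : ℂ) (t : ℝ) :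
    CircleIntegrable (deficit Λ c) z t :=
  circleIntegrable_log_div_norm (differentiable_expSum Λ c) (expSum_ne_zero hΛ hc)
    (continuous_absSum Λ c) (absSum_pos hΛ hc) z t

theorem exists_setLIntegral_ball_deficit_le (hΛ : Λ.Nonempty) (hc : ∀ a ∈ Λ, c a ≠ 0) :
    ∃ C ≥ 0, ∀ p, ∫⁻ z in ball p 1, ENNReal.ofReal (deficit Λ c z) ≤ ENNReal.ofReal C := by
  obtain ⟨C, hC, hdom⟩ := exists_deficit_le_pairSum hΛ hc
  obtain ⟨R, hR, hgood⟩ := exists_norm_sub_le_pairSum_le Λ (ε := 1 / 2 / C) (by positivity)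
  obtain ⟨L, hL, hgrowth⟩ := exists_absSum_le_mul_exp_norm_sub Λ c
  refine ⟨2 * π * (R + 1) ^ 2 * (2 + L * (R + 1)), by positivity, fun p => ?_⟩
  obtain ⟨w, hwp, hw⟩ := hgood p
  have hCw : C * pairSum Λ w ≤ 1 / 2 := (le_div_iff₀' hC).1 hw
  obtain ⟨hfw, hdef⟩ := hdom w hCw
  have hSw := absSum_pos hΛ hc w
  let A := absSum Λ c w * exp (L * (R + 1))
  have hSA : ∀ z ∈ ball w (R + 1), absSum Λ c z ≤ A := fun z hz => by
    refine (hgrowth w z).trans (mul_le_mul_of_nonneg_left ?_ hSw.le)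
    gcongr
    exact (mem_ball_iff_norm.1 hz).le
  have hAw : log (A / ‖expSum Λ c w‖) ≤ 2 + L * (R + 1) := by
    rw [mul_div_right_comm, log_mul (div_pos hSw (norm_pos_iff.2 hfw)).ne' (exp_ne_zero _), log_exp]
    change deficit Λ c w + L * (R + 1) ≤ _
    linarith
  calc ∫⁻ z in ball p 1, ENNReal.ofReal (deficit Λ c z)
      ≤ ∫⁻ z in ball w (R + 1), ENNReal.ofReal (deficit Λ c z) :=
        lintegral_mono_set (ball_subset_ball' (by rw [dist_comm, dist_eq_norm]; linarith))
    _ ≤ ∫⁻ z in ball w (R + 1), ENNReal.ofReal (log (A / ‖expSum Λ c z‖)) := by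
        refine setLIntegral_mono' measurableSet_ball fun z hz => ENNReal.ofReal_le_ofReal ?_
        rcases (norm_nonneg (expSum Λ c z)).eq_or_lt with h | h
        · simp [deficit, ← h]
        · have := absSum_pos hΛ hc z
          exact log_le_log (by positivity) (by gcongr; exact hSA z hz)
    _ ≤ ENNReal.ofReal (2 * π * (R + 1) ^ 2 * log (A / ‖expSum Λ c w‖)) :=
        setLIntegral_ball_log_div_norm_le (differentiable_expSum Λ c) (by positivity)
          (fun z hz => (norm_expSum_le_absSum Λ c z).trans (hSA z hz)) hfw
    _ ≤ ENNReal.ofReal (2 * π * (R + 1) ^ 2 * (2 + L * (R + 1))) := by gcongr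

theorem exists_setLIntegral_ball_deficit_le_pairSum (hΛ : Λ.Nonempty) (hc : ∀ a ∈ Λ, c a ≠ 0) :
    ∃ C ≥ 0, ∀ p, ∫⁻ z in ball p 1, ENNReal.ofReal (deficit Λ c z) ≤
      ENNReal.ofReal (C * pairSum Λ p) := by
  obtain ⟨C₁, hC₁, hdom⟩ := exists_deficit_le_pairSum hΛ hc
  obtain ⟨C₂, hC₂, hbound⟩ := exists_setLIntegral_ball_deficit_le hΛ hc
  obtain ⟨L, hL, hgrowth⟩ := exists_pairSum_le_mul_exp_norm_sub Λ
  let K := C₁ * exp L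
  have : 0 < K := by positivity
  refine ⟨4 * K * π + C₂ * (2 * K), by positivity, fun p => ?_⟩
  have hp := pairSum_nonneg Λ p
  rcases le_total (K * pairSum Λ p) (1 / 2) with hsmall | hlarge
  · have hball : ∀ z ∈ ball p 1, C₁ * pairSum Λ z ≤ K * pairSum Λ p := fun z hz => by
      calc C₁ * pairSum Λ z ≤ C₁ * (pairSum Λ p * exp (L * 1)) := by
            refine mul_le_mul_of_nonneg_left ((hgrowth p z).trans ?_) hC₁.le
            gcongr
            exact (mem_ball_iff_norm.1 hz).le
        _ = K * pairSum Λ p := by rw [mul_one, mul_left_comm, mul_comm]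
    calc ∫⁻ z in ball p 1, ENNReal.ofReal (deficit Λ c z)
        ≤ ∫⁻ _ in ball p 1, ENNReal.ofReal (4 * (K * pairSum Λ p)) := by
          refine setLIntegral_mono' measurableSet_ball fun z hz => ENNReal.ofReal_le_ofReal ?_
          have hz' := hball z hz
          linarith [(hdom z (hz'.trans hsmall)).2]
      _ = ENNReal.ofReal (4 * K * π * pairSum Λ p) := by
          rw [setLIntegral_const, Complex.volume_ball, ENNReal.ofReal_one, one_pow, one_mul,
            show (NNReal.pi : ENNReal) = ENNReal.ofReal π from (ENNReal.ofReal_coe_nnreal).symm,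
            ← ENNReal.ofReal_mul (by positivity)]
          ring_nf
      _ ≤ ENNReal.ofReal ((4 * K * π + C₂ * (2 * K)) * pairSum Λ p) := by
          gcongr
          exact le_add_of_nonneg_right (by positivity)
  · refine (hbound p).trans (ENNReal.ofReal_le_ofReal ?_)
    have hpos : 0 ≤ 4 * K * π * pairSum Λ p := by positivity
    calc C₂ ≤ C₂ * (2 * (K * pairSum Λ p)) := le_mul_of_one_le_right hC₂ (by linarith)
      _ ≤ (4 * K * π + C₂ * (2 * K)) * pairSum Λ p := by linarith

theorem measure_ball_mul_setLIntegral_le {E : Type*} [NormedAddCommGroup E] [MeasurableSpace E]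
    [BorelSpace E] [SecondCountableTopology E] {μ : Measure E} [SFinite μ] [μ.IsAddLeftInvariant]
    {D : E → ENNReal} (hD : Measurable D) {A : Set E} (hA : MeasurableSet A) (δ : ℝ) :
    μ (ball 0 δ) * ∫⁻ z in A, D z ∂μ ≤
      ∫⁻ p in thickening δ A, ∫⁻ z in ball p δ, D z ∂μ ∂μ := by
  have hmeas : Measurable (Function.uncurry fun p => (ball p δ).indicator D) :=
    (hD.comp measurable_snd).indicator (s := {q : E × E | dist q.2 q.1 < δ})
      (isOpen_lt (by fun_prop) (by fun_prop)).measurableSet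
  have hball : ∀ z ∈ A, (∫⁻ p in thickening δ A, (ball p δ).indicator D z ∂μ) =
      μ (ball 0 δ) * D z := by
    intro z hz
    have hind : ∀ p, (ball p δ).indicator D z = (ball z δ).indicator (fun _ => D z) p := fun p => by
      simp only [indicator, mem_ball, dist_comm]
    simp only [hind]
    rw [lintegral_indicator measurableSet_ball, setLIntegral_const,
      Measure.restrict_apply measurableSet_ball,
      inter_eq_left.2 (ball_subset_thickening hz δ), ← measure_preimage_add μ z (ball z δ),
      preimage_add_ball, sub_self, mul_comm]
  calc μ (ball 0 δ) * ∫⁻ z in A, D z ∂μ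
      = ∫⁻ z in A, ∫⁻ p in thickening δ A, (ball p δ).indicator D z ∂μ ∂μ := by
        rw [← lintegral_const_mul _ hD]
        exact (setLIntegral_congr_fun hA hball).symm
    _ ≤ ∫⁻ z, ∫⁻ p in thickening δ A, (ball p δ).indicator D z ∂μ ∂μ :=
        setLIntegral_le_lintegral _ _
    _ = ∫⁻ p in thickening δ A, ∫⁻ z, (ball p δ).indicator D z ∂μ ∂μ :=
        (lintegral_lintegral_swap hmeas.aemeasurable).symm
    _ = ∫⁻ p in thickening δ A, ∫⁻ z in ball p δ, D z ∂μ ∂μ := by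
        simp only [lintegral_indicator measurableSet_ball]

theorem exists_setLIntegral_annulus_pairSum_le (Λ : Finset ℂ) :
    ∃ C ≥ 0, ∀ r : ℝ, ∫⁻ z in (dist · 0) ⁻¹' Ioo (r - 1) (r + 2), ENNReal.ofReal (pairSum Λ z) ≤
      ENNReal.ofReal C := by
  obtain ⟨C, hC, havg⟩ := exists_circleAverage_pairSum_le Λ
  refine ⟨2 * π * C * 3, by positivity, fun r => ?_⟩
  rw [setLIntegral_dist_preimage (continuous_pairSum Λ).measurable measurableSet_Ioo
    (fun z _ => pairSum_nonneg Λ z)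
    fun ρ _ => (continuous_pairSum Λ).continuousOn.circleIntegrable']
  calc ∫⁻ ρ in Ioo (r - 1) (r + 2) ∩ Ioi 0,
        ENNReal.ofReal (2 * π * ρ * circleAverage (pairSum Λ) 0 ρ)
      ≤ ∫⁻ _ in Ioo (r - 1) (r + 2) ∩ Ioi 0, ENNReal.ofReal (2 * π * C) := by
        refine setLIntegral_mono' (measurableSet_Ioo.inter measurableSet_Ioi) fun ρ hρ =>
          ENNReal.ofReal_le_ofReal ?_
        have hρ0 : 0 < ρ := hρ.2
        calc 2 * π * ρ * circleAverage (pairSum Λ) 0 ρ ≤ 2 * π * ρ * (C / ρ) := by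
              gcongr
              exact havg ρ hρ0
          _ = 2 * π * C := by field_simp
    _ ≤ ENNReal.ofReal (2 * π * C) * volume (Ioo (r - 1) (r + 2)) := by
        rw [setLIntegral_const]
        gcongr
        exact inter_subset_left
    _ = ENNReal.ofReal (2 * π * C * 3) := by
        rw [volume_Ioo, show r + 2 - (r - 1) = 3 by ring, ← ENNReal.ofReal_mul (by positivity)]

theorem exists_setLIntegral_annulus_deficit_le (hΛ : Λ.Nonempty) (hc : ∀ a ∈ Λ, c a ≠ 0) :
    ∃ C ≥ 0, ∀ r : ℝ, ∫⁻ z in (dist · 0) ⁻¹' Icc r (r + 1), ENNReal.ofReal (deficit Λ c z) ≤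
      ENNReal.ofReal C := by
  obtain ⟨C₁, hC₁, hlocal⟩ := exists_setLIntegral_ball_deficit_le_pairSum hΛ hc
  obtain ⟨C₂, hC₂, hpair⟩ := exists_setLIntegral_annulus_pairSum_le Λ
  refine ⟨C₁ * C₂, by positivity, fun r => ?_⟩
  have hthick : thickening 1 ((dist · 0) ⁻¹' Icc r (r + 1)) ⊆
      (dist · (0 : ℂ)) ⁻¹' Ioo (r - 1) (r + 2) := by
    intro p hp
    obtain ⟨z, ⟨hz₁, hz₂⟩, hpz⟩ := mem_thickening_iff.1 hp
    constructor <;> linarith [dist_triangle p z 0, dist_triangle_left z 0 p]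
  have hvol : 1 ≤ volume (ball (0 : ℂ) 1) := by
    rw [Complex.volume_ball, ENNReal.ofReal_one, one_pow, one_mul]
    exact_mod_cast show (1 : ℝ) ≤ π by linarith [pi_gt_three]
  calc ∫⁻ z in (dist · 0) ⁻¹' Icc r (r + 1), ENNReal.ofReal (deficit Λ c z)
      ≤ volume (ball (0 : ℂ) 1) *
          ∫⁻ z in (dist · 0) ⁻¹' Icc r (r + 1), ENNReal.ofReal (deficit Λ c z) :=
        le_mul_of_one_le_left' hvol
    _ ≤ ∫⁻ p in thickening 1 ((dist · 0) ⁻¹' Icc r (r + 1)), ∫⁻ z in ball p 1,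
          ENNReal.ofReal (deficit Λ c z) :=
        measure_ball_mul_setLIntegral_le (measurable_deficit Λ c).ennreal_ofReal
          (measurableSet_Icc.preimage (by fun_prop)) 1
    _ ≤ ∫⁻ p in thickening 1 ((dist · 0) ⁻¹' Icc r (r + 1)), ENNReal.ofReal (C₁ * pairSum Λ p) :=
        lintegral_mono fun p => hlocal p
    _ ≤ ∫⁻ p in (dist · 0) ⁻¹' Ioo (r - 1) (r + 2), ENNReal.ofReal (C₁ * pairSum Λ p) :=
        lintegral_mono_set hthick
    _ = ENNReal.ofReal C₁ *
          ∫⁻ p in (dist · 0) ⁻¹' Ioo (r - 1) (r + 2), ENNReal.ofReal (pairSum Λ p) := by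
        simp only [ENNReal.ofReal_mul hC₁]
        exact lintegral_const_mul _ (continuous_pairSum Λ).measurable.ennreal_ofReal
    _ ≤ ENNReal.ofReal (C₁ * C₂) := by
        rw [ENNReal.ofReal_mul hC₁]
        gcongr
        exact hpair r

theorem exists_circleAverage_deficit_le (hΛ : Λ.Nonempty) (hc : ∀ a ∈ Λ, c a ≠ 0) :
    ∃ C ≥ 0, ∀ r > 0, ∃ t ∈ Icc r (r + 1), circleAverage (deficit Λ c) 0 t ≤ C / t := by
  obtain ⟨C, hC, hint⟩ := exists_setLIntegral_annulus_deficit_le hΛ hc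
  refine ⟨C + 1, by positivity, fun r hr => ?_⟩
  by_contra! hlarge
  have hIoi : Icc r (r + 1) ∩ Ioi 0 = Icc r (r + 1) :=
    inter_eq_left.2 fun ρ hρ => hr.trans_le hρ.1
  have hpolar := setLIntegral_dist_preimage (measurable_deficit Λ c) measurableSet_Icc
    (fun z _ => deficit_nonneg Λ c z)
    (fun ρ _ => circleIntegrable_deficit hΛ hc 0 ρ : ∀ ρ ∈ Icc r (r + 1), _)
  rw [hIoi] at hpolar
  have hlt : ENNReal.ofReal (C + 1) ≤ ENNReal.ofReal C :=
    calc ENNReal.ofReal (C + 1) = ∫⁻ _ in Icc r (r + 1), ENNReal.ofReal (C + 1) := by simp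
      _ ≤ ∫⁻ ρ in Icc r (r + 1),
          ENNReal.ofReal (2 * π * ρ * circleAverage (deficit Λ c) 0 ρ) := by
        refine setLIntegral_mono' measurableSet_Icc fun ρ hρ => ENNReal.ofReal_le_ofReal ?_
        have hρ0 : 0 < ρ := hr.trans_le hρ.1
        have hρC := (div_lt_iff₀' hρ0).1 (hlarge ρ hρ)
        have h2π : 1 ≤ 2 * π := by linarith [pi_gt_three]
        calc C + 1 ≤ ρ * circleAverage (deficit Λ c) 0 ρ := hρC.le
          _ ≤ 2 * π * (ρ * circleAverage (deficit Λ c) 0 ρ) :=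
            le_mul_of_one_le_left (by linarith) h2π
          _ = 2 * π * ρ * circleAverage (deficit Λ c) 0 ρ := (mul_assoc _ _ _).symm
      _ ≤ ENNReal.ofReal C := hpolar.symm.trans_le (hint r)
  rw [ENNReal.ofReal_le_ofReal_iff hC] at hlt
  linarith

end DeficitIntegral

section Jensen

variable {f : ℂ → ℂ}

theorem natCast_analyticOrderNatAt (hf : Differentiable ℂ f) (hf0 : f ≠ 0) (z : ℂ) :
    (analyticOrderNatAt f z : ℕ∞) = analyticOrderAt f z :=
  Nat.cast_analyticOrderNatAt <|
    mt (AnalyticOnNhd.analyticOrderAt_eq_top_iff_eq_zero z fun w => hf.analyticAt w).1 hf0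

theorem analyticOrderNatAt_ne_zero_iff (hf : Differentiable ℂ f) (hf0 : f ≠ 0) {z : ℂ} :
    analyticOrderNatAt f z ≠ 0 ↔ f z = 0 := by
  rw [← (hf.analyticAt z).analyticOrderAt_ne_zero, ← natCast_analyticOrderNatAt hf hf0,
    Nat.cast_ne_zero]

theorem divisor_apply_eq_analyticOrderNatAt (hf : Differentiable ℂ f) (hf0 : f ≠ 0) {U : Set ℂ}
    {z : ℂ} (hz : z ∈ U) : MeromorphicOn.divisor f U z = analyticOrderNatAt f z := by
  rw [MeromorphicOn.AnalyticOnNhd.divisor_apply (fun w _ => hf.analyticAt w) hz,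
    ← natCast_analyticOrderNatAt hf hf0]
  rfl

theorem finite_zeros (hf : Differentiable ℂ f) (hf0 : f ≠ 0) (r : ℝ) :
    {z | z ∈ closedBall 0 r ∧ f z = 0}.Finite := by
  refine ((MeromorphicOn.divisor f (closedBall 0 r)).finiteSupport
    (isCompact_closedBall 0 r)).subset ?_
  rintro z ⟨hz, hfz⟩
  rw [Function.mem_support, divisor_apply_eq_analyticOrderNatAt hf hf0 hz]
  exact_mod_cast (analyticOrderNatAt_ne_zero_iff hf hf0).2 hfz

theorem finsum_closedBall_eq_sum {M : Type*} [AddCommMonoid M] (hf : Differentiable ℂ f)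
    (hf0 : f ≠ 0) {g : ℂ → M} (hg : ∀ z, f z ≠ 0 → g z = 0) {s t : ℝ} (hst : s ≤ t) :
    ∑ᶠ z ∈ closedBall 0 s, g z = ∑ z ∈ (finite_zeros hf hf0 t).toFinset with ‖z‖ ≤ s, g z := by
  refine finsum_mem_eq_sum_of_inter_support_eq _ ?_
  ext z
  have hsupp : g z ≠ 0 → f z = 0 := not_imp_comm.1 (hg z)
  have hle : ‖z‖ ≤ s → ‖z‖ ≤ t := fun h => h.trans hst
  simp only [mem_inter_iff, mem_closedBall_zero_iff, Function.mem_support, Finset.coe_filter,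
    Finite.mem_toFinset, mem_ofPred_eq]
  tauto

theorem zeroCount_eq_sum (hf : Differentiable ℂ f) (hf0 : f ≠ 0) {s t : ℝ} (hst : s ≤ t) :
    zeroCount f s =
      ∑ z ∈ (finite_zeros hf hf0 t).toFinset with ‖z‖ ≤ s, analyticOrderNatAt f z :=
  finsum_closedBall_eq_sum hf hf0
    (fun _ => not_imp_comm.1 (analyticOrderNatAt_ne_zero_iff hf hf0).1) hst

theorem zeroCount_mono (hf : Differentiable ℂ f) (hf0 : f ≠ 0) : Monotone (zeroCount f) := by
  intro s t hst
  rw [zeroCount_eq_sum hf hf0 hst, zeroCount_eq_sum hf hf0 le_rfl]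
  exact Finset.sum_le_sum_of_subset
    (Finset.monotone_filter_right _ fun z _ (hz : ‖z‖ ≤ s) => hz.trans hst)

-- A zero at the origin is covered as well: there `log ‖z‖ = log 0 = 0`.
theorem circleAverage_log_norm_eq_sum (hf : Differentiable ℂ f) (hf0 : f ≠ 0) {s t : ℝ}
    (hs : 0 < s) (hst : s ≤ t) :
    circleAverage (fun z => log ‖f z‖) 0 s =
      ∑ z ∈ (finite_zeros hf hf0 t).toFinset with ‖z‖ ≤ s,
        analyticOrderNatAt f z * (log s - log ‖z‖) + log ‖meromorphicTrailingCoeffAt f 0‖ := by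
  let D := MeromorphicOn.divisor f (closedBall 0 s)
  have hD : ∀ z, (D z : ℝ) * (log s - log ‖0 - z‖) =
      ∑ᶠ _ : z ∈ closedBall (0 : ℂ) s, (analyticOrderNatAt f z : ℝ) * (log s - log ‖z‖) := by
    intro z
    rw [zero_sub, norm_neg]
    by_cases hz : z ∈ closedBall (0 : ℂ) s
    · simp only [D, hz, divisor_apply_eq_analyticOrderNatAt hf hf0 hz, finsum_true,
        Int.cast_natCast]
    · simp only [D.apply_eq_zero_of_notMem hz, hz, finsum_false, Int.cast_zero, zero_mul]
  rw [MeromorphicOn.circleAverage_log_norm hs.ne' fun z _ => (hf.analyticAt z).meromorphicAt,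
    abs_of_pos hs,
    ← countingFunction_finsum_eq_finsum_add hs.ne' (D.finiteSupport (isCompact_closedBall 0 s)),
    finsum_congr hD, finsum_closedBall_eq_sum hf hf0 (fun z hz => ?_) hst]
  rw [not_imp_comm.1 (analyticOrderNatAt_ne_zero_iff hf hf0).1 hz, Nat.cast_zero, zero_mul]

theorem circleAverage_log_norm_sub_eq_sum (hf : Differentiable ℂ f) (hf0 : f ≠ 0) {s t : ℝ}
    (hs : 0 < s) (hst : s ≤ t) :
    circleAverage (fun z => log ‖f z‖) 0 t - circleAverage (fun z => log ‖f z‖) 0 s =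
      ∑ z ∈ (finite_zeros hf hf0 t).toFinset,
        analyticOrderNatAt f z * (log t - if ‖z‖ ≤ s then log s else log ‖z‖) := by
  have hle : ∀ z ∈ (finite_zeros hf hf0 t).toFinset, ‖z‖ ≤ t := fun z hz =>
    mem_closedBall_zero_iff.1 ((Finite.mem_toFinset _).1 hz).1
  rw [circleAverage_log_norm_eq_sum hf hf0 hs hst,
    circleAverage_log_norm_eq_sum hf hf0 (hs.trans_le hst) le_rfl, add_sub_add_right_eq_sub,
    Finset.filter_true_of_mem hle, Finset.sum_filter, ← Finset.sum_sub_distrib]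
  refine Finset.sum_congr rfl fun z _ => ?_
  split_ifs <;> ring

theorem zeroCount_mul_log_sub_log_le (hf : Differentiable ℂ f) (hf0 : f ≠ 0) {s t : ℝ}
    (hs : 0 < s) (hst : s ≤ t) :
    zeroCount f s * (log t - log s) ≤
      circleAverage (fun z => log ‖f z‖) 0 t - circleAverage (fun z => log ‖f z‖) 0 s := by
  rw [circleAverage_log_norm_sub_eq_sum hf hf0 hs hst, zeroCount_eq_sum hf hf0 hst, Nat.cast_sum,
    Finset.sum_mul, Finset.sum_filter]
  refine Finset.sum_le_sum fun z hz => ?_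
  split_ifs with hzs
  · rfl
  · have hzt : ‖z‖ ≤ t := mem_closedBall_zero_iff.1 ((Finite.mem_toFinset _).1 hz).1
    have hz0 : 0 < ‖z‖ := hs.trans (not_le.1 hzs)
    exact mul_nonneg (Nat.cast_nonneg _) (sub_nonneg.2 (log_le_log hz0 hzt))

theorem circleAverage_log_norm_sub_le (hf : Differentiable ℂ f) (hf0 : f ≠ 0) {s t : ℝ}
    (hs : 0 < s) (hst : s ≤ t) :
    circleAverage (fun z => log ‖f z‖) 0 t - circleAverage (fun z => log ‖f z‖) 0 s ≤
      zeroCount f t * (log t - log s) := by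
  have hle : ∀ z ∈ (finite_zeros hf hf0 t).toFinset, ‖z‖ ≤ t := fun z hz =>
    mem_closedBall_zero_iff.1 ((Finite.mem_toFinset _).1 hz).1
  rw [circleAverage_log_norm_sub_eq_sum hf hf0 hs hst, zeroCount_eq_sum hf hf0 le_rfl,
    Finset.filter_true_of_mem hle, Nat.cast_sum, Finset.sum_mul]
  refine Finset.sum_le_sum fun z _ => ?_
  gcongr
  split_ifs with hzs
  · rfl
  · exact log_le_log hs (not_le.1 hzs).le

end Jensen

section Jumps

theorem eventually_nhdsGT_filter_le_eq (B : Finset ℝ) (x : ℝ) :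
    ∀ᶠ y in 𝓝[>] x, {θ ∈ B | θ ≤ y} = {θ ∈ B | θ ≤ x} := by
  have hiff : ∀ᶠ y in 𝓝[>] x, ∀ θ ∈ B, (θ ≤ y ↔ θ ≤ x) :=
    (eventually_all_finset B).2 fun θ _ => by
      rcases le_or_gt θ x with h | h
      · filter_upwards [self_mem_nhdsWithin] with y (hy : x < y)
        simp only [h, h.trans hy.le]
      · filter_upwards [nhdsWithin_le_nhds (Iio_mem_nhds h)] with y (hy : y < θ)
        simp only [hy.not_ge, h.not_ge]
  exact hiff.mono fun y hy => Finset.filter_congr hy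

theorem eventually_nhdsLT_filter_le_eq (B : Finset ℝ) (x : ℝ) :
    ∀ᶠ y in 𝓝[<] x, {θ ∈ B | θ ≤ y} = {θ ∈ B | θ < x} := by
  have hiff : ∀ᶠ y in 𝓝[<] x, ∀ θ ∈ B, (θ ≤ y ↔ θ < x) :=
    (eventually_all_finset B).2 fun θ _ => by
      rcases lt_or_ge θ x with h | h
      · filter_upwards [nhdsWithin_le_nhds (Ioi_mem_nhds h)] with y (hy : θ < y)
        simp only [h, hy.le]
      · filter_upwards [self_mem_nhdsWithin] with y (hy : y < x)
        simp only [h.not_gt, (hy.trans_le h).not_ge]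
  exact hiff.mono fun y hy => Finset.filter_congr hy

theorem eq_of_eventually_eq_nhdsGT_nhdsLT {P : ℝ → ℝ} {a b : ℝ} (hab : a ≤ b)
    (hright : ∀ x ∈ Ico a b, ∀ᶠ y in 𝓝[>] x, P y = P x)
    (hleft : ∀ x ∈ Ioc a b, ∀ᶠ y in 𝓝[<] x, P y = P x) : P b = P a := by
  have hr : ∀ x ∈ Ico a b, HasDerivWithinAt P 0 (Ici x) x := fun x hx =>
    ((hasDerivWithinAt_const x (Ioi x) (P x)).congr_of_eventuallyEq (hright x hx) rfl).Ici_of_Ioi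
  have hl : ∀ x ∈ Ioc a b, ContinuousWithinAt P (Iic x) x := fun x hx =>
    continuousWithinAt_Iio_iff_Iic.1
      (continuousWithinAt_const.congr_of_eventuallyEq (hleft x hx) rfl)
  refine constant_of_has_deriv_right_zero (fun x hx => ?_) hr b (right_mem_Icc.2 hab)
  rcases hx.1.eq_or_lt with rfl | hax
  · rcases hx.2.eq_or_lt with rfl | hxb
    · simp
    · exact (hr a ⟨le_rfl, hxb⟩).continuousWithinAt.mono Icc_subset_Ici_self
  · rcases hx.2.eq_or_lt with rfl | hxb
    · exact (hl x ⟨hax, le_rfl⟩).mono Icc_subset_Iic_self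
    · exact ((hl x ⟨hax, hx.2⟩).union (hr x ⟨hx.1, hxb⟩).continuousWithinAt).mono
        fun y _ => le_total y x

theorem sub_eq_finsum_of_eventually_eq {P J : ℝ → ℝ} {a b : ℝ} (hab : a ≤ b)
    (hfin : (Ioc a b ∩ Function.support J).Finite)
    (hright : ∀ x ∈ Ico a b, ∀ᶠ y in 𝓝[>] x, P y = P x)
    (hleft : ∀ x ∈ Ioc a b, ∀ᶠ y in 𝓝[<] x, P y = P x - J x) :
    P b - P a = ∑ᶠ x ∈ Ioc a b, J x := by
  let B := hfin.toFinset
  have hBIoc : ∀ θ ∈ B, θ ∈ Ioc a b := fun θ hθ => ((Finite.mem_toFinset _).1 hθ).1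
  let S : ℝ → ℝ := fun x => ∑ θ ∈ B with θ ≤ x, J θ
  have hjump : ∀ x ∈ Ioc a b, S x = ∑ θ ∈ B with θ < x, J θ + J x := fun x hx => by
    have hJx : J x = ∑ θ ∈ B with θ = x, J θ := by
      rw [Finset.filter_eq']
      split_ifs with hxB
      · rw [Finset.sum_singleton]
      · by_contra hJ0
        exact hxB ((Finite.mem_toFinset _).2 ⟨hx, hJ0⟩)
    rw [hJx, ← Finset.sum_union
      (Finset.disjoint_filter.2 fun θ _ (hlt : θ < x) heq => hlt.ne heq), ← Finset.filter_or]
    exact Finset.sum_congr (Finset.filter_congr fun θ _ => le_iff_lt_or_eq) fun _ _ => rfl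
  have hconst : P b - S b = P a - S a := by
    refine eq_of_eventually_eq_nhdsGT_nhdsLT (P := fun x => P x - S x) hab (fun x hx => ?_)
      fun x hx => ?_
    · filter_upwards [hright x hx, eventually_nhdsGT_filter_le_eq B x] with y hP hS
      simp only [S, hP, hS]
    · filter_upwards [hleft x hx, eventually_nhdsLT_filter_le_eq B x] with y hP hS
      rw [hjump x hx, hP]
      simp only [S, hS]
      ring
  have hSa : S a = 0 := by
    simp only [S, Finset.filter_false_of_mem fun θ hθ => (hBIoc θ hθ).1.not_ge, Finset.sum_empty]
  have hSb : S b = ∑ θ ∈ B, J θ := by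
    simp only [S, Finset.filter_true_of_mem fun θ hθ => (hBIoc θ hθ).2]
  rw [finsum_mem_eq_sum J hfin]
  linarith

end Jumps

section Faces

variable {E : Type*} [NormedAddCommGroup E] [InnerProductSpace ℝ E] {Λ : Finset E}

theorem maxFace_eq_singleton {a u : E} (ha : a ∈ Λ) (h : ∀ b ∈ Λ, b ≠ a → ⟪u, b⟫_ℝ < ⟪u, a⟫_ℝ) :
    maxFace Λ u = {a} := by
  ext b
  rw [mem_maxFace, Finset.mem_singleton]
  constructor
  · rintro ⟨hb, hmax⟩
    by_contra hne
    exact (h b hb hne).not_ge (hmax a ha)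
  · rintro rfl
    exact ⟨ha, fun d hd => (eq_or_ne d b).elim (fun h => h ▸ le_rfl) fun hne => (h d hd hne).le⟩

theorem eventually_pos_nhdsGT_of_hasDerivAt {g : ℝ → ℝ} {g' x : ℝ} (hg : HasDerivAt g g' x)
    (hx : g x = 0) (hg' : 0 < g') : ∀ᶠ y in 𝓝[>] x, 0 < g y := by
  have hslope := (hasDerivAt_iff_tendsto_slope.1 hg).mono_left
    (nhdsWithin_mono x fun y (hy : x < y) => hy.ne')
  filter_upwards [hslope.eventually (lt_mem_nhds hg'), self_mem_nhdsWithin] with y hy hxy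
  rw [slope_def_field, hx, sub_zero] at hy
  exact (div_pos_iff_of_pos_right (sub_pos.2 hxy)).1 hy

theorem eventually_maxFace_eq_singleton {γ : ℝ → E} {v a : E} {x : ℝ} (hγ : HasDerivAt γ v x)
    (hγv : ∀ d, ⟪γ x, d⟫_ℝ = 0 → ⟪v, d⟫_ℝ = 0 → d = 0)
    (ha : a ∈ maxFace (maxFace Λ (γ x)) v) : ∀ᶠ y in 𝓝[>] x, maxFace Λ (γ y) = {a} := by
  obtain ⟨ha, hmax'⟩ := mem_maxFace.1 ha
  obtain ⟨haΛ, hmax⟩ := mem_maxFace.1 ha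
  have hderiv : ∀ d, HasDerivAt (fun y => ⟪γ y, d⟫_ℝ) ⟪v, d⟫_ℝ x := fun d => by
    simpa using hγ.inner ℝ (hasDerivAt_const x d)
  have hlt : ∀ b ∈ Λ, ∀ᶠ y in 𝓝[>] x, b ≠ a → ⟪γ y, b⟫_ℝ < ⟪γ y, a⟫_ℝ := by
    intro b hb
    suffices hpos : b ≠ a → ∀ᶠ y in 𝓝[>] x, 0 < ⟪γ y, a - b⟫_ℝ by
      by_cases hba : b = a
      · exact Eventually.of_forall fun y hne => absurd hba hne
      · filter_upwards [hpos hba] with y hy _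
        rwa [inner_sub_right, sub_pos] at hy
    intro hba
    rcases (hmax b hb).eq_or_lt with heq | hlt
    · have hbmax : b ∈ maxFace Λ (γ x) := mem_maxFace.2 ⟨hb, fun d hd => heq ▸ hmax d hd⟩
      have hzero : ⟪γ x, a - b⟫_ℝ = 0 := by rw [inner_sub_right, heq, sub_self]
      refine eventually_pos_nhdsGT_of_hasDerivAt (hderiv _) hzero (lt_of_le_of_ne ?_ fun h => ?_)
      · rw [inner_sub_right, sub_nonneg]
        exact hmax' b hbmax
      · exact hba (sub_eq_zero.1 (hγv _ hzero h.symm)).symm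
    · have hx : 0 < ⟪γ x, a - b⟫_ℝ := by rwa [inner_sub_right, sub_pos]
      exact ((hderiv _).continuousAt.eventually (lt_mem_nhds hx)).filter_mono nhdsWithin_le_nhds
  filter_upwards [(eventually_all_finset Λ).2 hlt] with y hy using maxFace_eq_singleton haΛ hy

end Faces

section Perimeter

variable {Λ : Finset ℂ}

theorem norm_eq_abs_inner_mul_I {u d : ℂ} (hu : ‖u‖ = 1) (h : ⟪u, d⟫_ℝ = 0) :
    ‖d‖ = |⟪u * Complex.I, d⟫_ℝ| := by
  have hsq : ⟪u, d⟫_ℝ ^ 2 + ⟪u * Complex.I, d⟫_ℝ ^ 2 = ‖u‖ ^ 2 * ‖d‖ ^ 2 := by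
    rw [← Complex.normSq_eq_norm_sq, ← Complex.normSq_eq_norm_sq, Complex.inner, Complex.inner]
    simp only [Complex.normSq_apply, Complex.mul_re, Complex.mul_im, map_mul, Complex.conj_re,
      Complex.conj_im, Complex.conj_I, Complex.neg_re, Complex.neg_im, Complex.I_re, Complex.I_im]
    ring
  rw [h, hu, zero_pow two_ne_zero, zero_add, one_pow, one_mul] at hsq
  rw [← abs_norm d]
  exact (sq_eq_sq_iff_abs_eq_abs _ _).1 hsq.symm

theorem face_newtonPolygon (Λ : Finset ℂ) (u : ℂ) :
    face (newtonPolygon Λ) u = convexHull ℝ (maxFace Λ u) := by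
  let l : StrongDual ℝ ℂ := innerSL ℝ u
  have hexp : IsExposed ℝ (newtonPolygon Λ) (face (newtonPolygon Λ) u) := fun _ => ⟨l, rfl⟩
  have hΛΔ : (Λ : Set ℂ) ⊆ newtonPolygon Λ := subset_convexHull ℝ _
  have hΔ : IsCompact (newtonPolygon Λ) := Λ.finite_toSet.isCompact_convexHull ℝ
  have hface : Convex ℝ (face (newtonPolygon Λ) u) := hexp.convex (convex_convexHull ℝ _)
  refine Subset.antisymm ?_ (convexHull_min (fun a ha => ?_) hface)
  · have hext : (face (newtonPolygon Λ) u).extremePoints ℝ ⊆ maxFace Λ u := by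
      rw [hexp.isExtreme.extremePoints_eq]
      exact fun a ⟨haF, haΔ⟩ => mem_maxFace.2
        ⟨extremePoints_convexHull_subset haΔ, fun b hb => haF.2 b (hΛΔ hb)⟩
    rw [← closure_convexHull_extremePoints (hexp.isCompact hΔ) hface]
    exact closure_minimal (convexHull_mono hext)
      ((maxFace Λ u).finite_toSet.isClosed_convexHull ℝ)
  · obtain ⟨haΛ, hmax⟩ := mem_maxFace.1 ha
    exact ⟨hΛΔ haΛ, convexHull_min hmax (convex_halfSpace_le (innerSL ℝ u).isLinear _)⟩

theorem diam_face_newtonPolygon (hΛ : Λ.Nonempty) {u : ℂ} (hu : ‖u‖ = 1) :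
    diam (face (newtonPolygon Λ) u) =
      supportFun (maxFace Λ u) (u * Complex.I) + supportFun (maxFace Λ u) (-(u * Complex.I)) := by
  have hM := maxFace_nonempty hΛ u
  rw [face_newtonPolygon, convexHull_diam]
  obtain ⟨a, ha⟩ := maxFace_nonempty hM (u * Complex.I)
  obtain ⟨b, hb⟩ := maxFace_nonempty hM (-(u * Complex.I))
  have hdist : ∀ x ∈ maxFace Λ u, ∀ y ∈ maxFace Λ u, dist x y = |⟪u * Complex.I, x - y⟫_ℝ| :=
    fun x hx y hy => (dist_eq_norm x y).trans <| norm_eq_abs_inner_mul_I hu <| by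
      rw [inner_sub_right, ← supportFun_eq_inner hx, ← supportFun_eq_inner hy, sub_self]
  have hle : ∀ x ∈ maxFace Λ u, ∀ y ∈ maxFace Λ u, ⟪u * Complex.I, x - y⟫_ℝ ≤
      supportFun (maxFace Λ u) (u * Complex.I) + supportFun (maxFace Λ u) (-(u * Complex.I)) :=
    fun x hx y hy => by
      rw [inner_sub_right, sub_eq_add_neg, ← inner_neg_left]
      exact add_le_add (inner_le_supportFun hx _) (inner_le_supportFun hy _)
  apply le_antisymm
  · refine diam_le_of_forall_dist_le_of_nonempty hM fun x hx y hy => ?_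
    rw [hdist x hx y hy]
    refine abs_le'.2 ⟨hle x hx y hy, ?_⟩
    rw [← inner_neg_right, neg_sub]
    exact hle y hy x hx
  · have haM := (mem_maxFace.1 ha).1
    have hbM := (mem_maxFace.1 hb).1
    calc supportFun (maxFace Λ u) (u * Complex.I) + supportFun (maxFace Λ u) (-(u * Complex.I))
        = ⟪u * Complex.I, a - b⟫_ℝ := by
          rw [supportFun_eq_inner ha, supportFun_eq_inner hb, inner_sub_right, inner_neg_left,
            sub_eq_add_neg]
      _ ≤ |⟪u * Complex.I, a - b⟫_ℝ| := le_abs_self _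
      _ = dist a b := (hdist a haM b hbM).symm
      _ ≤ diam (maxFace Λ u) := dist_le_diam_of_mem (maxFace Λ u).finite_toSet.isBounded haM hbM

theorem eventually_maxFace_circleMap_nhdsGT {a : ℂ} {x : ℝ}
    (ha : a ∈ maxFace (maxFace Λ (circleMap 0 1 x)) (circleMap 0 1 x * Complex.I)) :
    ∀ᶠ y in 𝓝[>] x, maxFace Λ (circleMap 0 1 y) = {a} := by
  refine eventually_maxFace_eq_singleton (hasDerivAt_circleMap 0 1 x) (fun d hd hd' => ?_) ha
  rw [← norm_eq_zero, norm_eq_abs_inner_mul_I (by simp) hd, hd', abs_zero]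

theorem eventually_maxFace_circleMap_nhdsLT {a : ℂ} {x : ℝ}
    (ha : a ∈ maxFace (maxFace Λ (circleMap 0 1 x)) (-(circleMap 0 1 x * Complex.I))) :
    ∀ᶠ y in 𝓝[<] x, maxFace Λ (circleMap 0 1 y) = {a} := by
  have hderiv : HasDerivAt (fun y => circleMap 0 1 (-y)) (-(circleMap 0 1 x * Complex.I)) (-x) := by
    simpa [Function.comp_def] using
      (hasDerivAt_circleMap 0 1 (- -x)).scomp (-x) (hasDerivAt_neg (-x))
  have hev : ∀ᶠ y in 𝓝[>] (-x), maxFace Λ (circleMap 0 1 (-y)) = {a} := by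
    refine eventually_maxFace_eq_singleton hderiv (fun d hd hd' => ?_) (by rwa [neg_neg])
    rw [neg_neg] at hd
    rw [← norm_eq_zero, norm_eq_abs_inner_mul_I (by simp) hd, ← abs_neg, ← inner_neg_left, hd',
      abs_zero]
  filter_upwards [tendsto_neg_nhdsLT.eventually hev] with y hy
  rwa [neg_neg] at hy

theorem intervalIntegrable_supportFun_circleMap (Λ : Finset ℂ) (x y : ℝ) :
    IntervalIntegrable (fun θ => supportFun Λ (circleMap 0 1 θ)) volume x y :=
  ((continuous_supportFun Λ).comp (continuous_circleMap 0 1)).intervalIntegrable x y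

theorem integral_supportFun_circleMap_of_forall_mem_maxFace {a : ℂ} {x y : ℝ}
    (ha : ∀ θ ∈ uIoo x y, a ∈ maxFace Λ (circleMap 0 1 θ)) :
    ∫ θ in x..y, supportFun Λ (circleMap 0 1 θ) =
      ⟪circleMap 0 1 x * Complex.I, a⟫_ℝ - ⟪circleMap 0 1 y * Complex.I, a⟫_ℝ := by
  have hderiv : ∀ θ : ℝ, HasDerivAt (fun θ => -⟪circleMap 0 1 θ * Complex.I, a⟫_ℝ)
      ⟪circleMap 0 1 θ, a⟫_ℝ θ := fun θ => by
    have h := ((hasDerivAt_circleMap 0 1 θ).mul_const Complex.I).inner ℝ (hasDerivAt_const θ a)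
    rw [mul_assoc _ Complex.I, Complex.I_mul_I, mul_neg_one, inner_neg_left, inner_zero_right,
      zero_add] at h
    exact neg_neg ⟪circleMap 0 1 θ, a⟫_ℝ ▸ h.neg
  rw [intervalIntegral.integral_congr_uIoo fun θ hθ => supportFun_eq_inner (ha θ hθ),
    intervalIntegral.integral_eq_sub_of_hasDerivAt (fun θ _ => hderiv θ)
      (Continuous.intervalIntegrable (by fun_prop) _ _)]
  ring

/-- For `h θ = supportFun Λ (circleMap 0 1 θ)`, the function `∫ h + h'`, where `h'` is the right
derivative of `h`. The curvature measure `h + h''` of the boundary of the Newton polygon lives on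
the normals to its sides, so that this is a step function whose jumps are the lengths of the
sides. -/
noncomputable def boundaryLength (Λ : Finset ℂ) (x : ℝ) : ℝ :=
  (∫ θ in 0..x, supportFun Λ (circleMap 0 1 θ)) +
    supportFun (maxFace Λ (circleMap 0 1 x)) (circleMap 0 1 x * Complex.I)

theorem boundaryLength_sub (Λ : Finset ℂ) (x y : ℝ) :
    boundaryLength Λ y - boundaryLength Λ x =
      (∫ θ in x..y, supportFun Λ (circleMap 0 1 θ)) +
        (supportFun (maxFace Λ (circleMap 0 1 y)) (circleMap 0 1 y * Complex.I) -
          supportFun (maxFace Λ (circleMap 0 1 x)) (circleMap 0 1 x * Complex.I)) := by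
  have := intervalIntegral.integral_add_adjacent_intervals
    (intervalIntegrable_supportFun_circleMap Λ 0 x) (intervalIntegrable_supportFun_circleMap Λ x y)
  simp only [boundaryLength]
  linarith

theorem eventually_boundaryLength_nhdsGT (hΛ : Λ.Nonempty) (x : ℝ) :
    ∀ᶠ y in 𝓝[>] x, boundaryLength Λ y = boundaryLength Λ x := by
  obtain ⟨a, ha⟩ := maxFace_nonempty (maxFace_nonempty hΛ (circleMap 0 1 x))
    (circleMap 0 1 x * Complex.I)
  obtain ⟨z, hz, hsub⟩ :=
    mem_nhdsGT_iff_exists_Ioo_subset.1 (eventually_maxFace_circleMap_nhdsGT ha)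
  filter_upwards [Ioo_mem_nhdsGT hz] with y hy
  have hmem : ∀ θ ∈ uIoo x y, a ∈ maxFace Λ (circleMap 0 1 θ) := fun θ hθ => by
    rw [uIoo_of_lt hy.1] at hθ
    exact (hsub ⟨hθ.1, hθ.2.trans hy.2⟩ : maxFace _ _ = _) ▸ Finset.mem_singleton_self a
  rw [← sub_eq_zero, boundaryLength_sub, integral_supportFun_circleMap_of_forall_mem_maxFace hmem,
    supportFun_eq_inner ha, show maxFace Λ (circleMap 0 1 y) = {a} from hsub hy,
    supportFun_singleton]
  ring

theorem eventually_boundaryLength_nhdsLT (hΛ : Λ.Nonempty) (x : ℝ) :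
    ∀ᶠ y in 𝓝[<] x, boundaryLength Λ y =
      boundaryLength Λ x - diam (face (newtonPolygon Λ) (circleMap 0 1 x)) := by
  obtain ⟨a, ha⟩ := maxFace_nonempty (maxFace_nonempty hΛ (circleMap 0 1 x))
    (-(circleMap 0 1 x * Complex.I))
  obtain ⟨z, hz, hsub⟩ :=
    mem_nhdsLT_iff_exists_Ioo_subset.1 (eventually_maxFace_circleMap_nhdsLT ha)
  filter_upwards [Ioo_mem_nhdsLT hz] with y hy
  have hmem : ∀ θ ∈ uIoo y x, a ∈ maxFace Λ (circleMap 0 1 θ) := fun θ hθ => by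
    rw [uIoo_of_lt hy.2] at hθ
    exact (hsub ⟨hy.1.trans hθ.1, hθ.2⟩ : maxFace _ _ = _) ▸ Finset.mem_singleton_self a
  have hsub' := boundaryLength_sub Λ y x
  rw [integral_supportFun_circleMap_of_forall_mem_maxFace hmem,
    show maxFace Λ (circleMap 0 1 y) = {a} from hsub hy, supportFun_singleton] at hsub'
  rw [diam_face_newtonPolygon hΛ (by simp), supportFun_eq_inner ha, inner_neg_left]
  linarith

theorem bijOn_circleMap_Ioc_sphere (c : ℂ) {R : ℝ} (hR : R ≠ 0) :
    BijOn (circleMap c R) (Ioc 0 (2 * π)) (sphere c |R|) := by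
  have hinj : InjOn (circleMap c R) (uIoc 0 (2 * π)) :=
    injOn_circleMap_of_abs_sub_le hR (by simp [abs_of_pos pi_pos])
  rw [uIoc_of_le two_pi_pos.le] at hinj
  exact image_circleMap_Ioc c R ▸ hinj.bijOn_image

theorem circleAverage_supportFun (hΛ : Λ.Nonempty) :
    circleAverage (supportFun Λ) 0 1 = semiperimeter (newtonPolygon Λ) / π := by
  let L : ℂ → ℝ := fun u => diam (face (newtonPolygon Λ) u)
  have hbij : BijOn (circleMap 0 1) (Ioc 0 (2 * π)) (sphere 0 1) := by
    simpa using bijOn_circleMap_Ioc_sphere 0 one_ne_zero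
  have hfin : (Ioc 0 (2 * π) ∩ Function.support fun θ => L (circleMap 0 1 θ)).Finite := by
    refine Finite.of_finite_image ((finite_sides Λ).subset ?_) (hbij.injOn.mono inter_subset_left)
    rintro _ ⟨θ, ⟨hθ, hL⟩, rfl⟩
    exact ⟨hbij.mapsTo hθ, hL⟩
  have hperiod : circleMap 0 1 (2 * π) = circleMap 0 1 0 := by simp [circleMap]
  have hint : ∫ θ in 0..2 * π, supportFun Λ (circleMap 0 1 θ) =
      ∑ᶠ θ ∈ Ioc 0 (2 * π), L (circleMap 0 1 θ) := by
    rw [← sub_eq_finsum_of_eventually_eq two_pi_pos.le hfin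
      (fun x _ => eventually_boundaryLength_nhdsGT hΛ x)
      fun x _ => eventually_boundaryLength_nhdsLT hΛ x, boundaryLength_sub, hperiod, sub_self,
      add_zero]
  rw [semiperimeter, ← finsum_mem_eq_of_bijOn (f := fun θ => L (circleMap 0 1 θ)) _ hbij
    fun _ _ => rfl, circleAverage_def, hint, smul_eq_mul]
  field_simp

end Perimeter

section Growth

variable {Λ : Finset ℂ} {c : ℂ → ℂ}

theorem circleAverage_zero_eq_circleAverage_smul (f : ℂ → ℝ) (t : ℝ) :
    circleAverage f 0 t = circleAverage (fun u => f (t • u)) 0 1 := by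
  simp only [circleAverage_eq_circleAverage_zero_one (f := f), add_zero, Complex.real_smul]

theorem circleAverage_const_mul (a : ℝ) (f : ℂ → ℝ) (z : ℂ) (R : ℝ) :
    circleAverage (fun w => a * f w) z R = a * circleAverage f z R :=
  circleAverage_fun_smul (a := a)

theorem circleIntegrable_log_absSum_smul (hΛ : Λ.Nonempty) (hc : ∀ a ∈ Λ, c a ≠ 0) (t : ℝ)
    (z : ℂ) (R : ℝ) : CircleIntegrable (fun u => log (absSum Λ c (t • u))) z R :=
  circleIntegrable_log ((continuous_absSum Λ c).comp (continuous_const_smul t))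
    (fun _ => absSum_pos hΛ hc _) z R

theorem circleIntegrable_mul_supportFun (Λ : Finset ℂ) (r : ℝ) (z : ℂ) (R : ℝ) :
    CircleIntegrable (fun u => r * supportFun Λ u) z R :=
  ((continuous_supportFun Λ).const_mul r).continuousOn.circleIntegrable'

theorem circleAverage_log_absSum_sub_le (hΛ : Λ.Nonempty) (hc : ∀ a ∈ Λ, c a ≠ 0) {s t : ℝ}
    (hst : s ≤ t) :
    circleAverage (fun z => log (absSum Λ c z)) 0 t -
        circleAverage (fun z => log (absSum Λ c z)) 0 s ≤
      (t - s) * (semiperimeter (newtonPolygon Λ) / π) := by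
  have hS := circleIntegrable_log_absSum_smul hΛ hc
  have hh := circleIntegrable_mul_supportFun Λ
  rw [circleAverage_zero_eq_circleAverage_smul _ t, circleAverage_zero_eq_circleAverage_smul _ s,
    ← circleAverage_supportFun hΛ, sub_le_iff_le_add', ← circleAverage_const_mul,
    ← circleAverage_fun_add (hS s 0 1) (hh (t - s) 0 1)]
  exact circleAverage_mono (hS t 0 1) ((hS s 0 1).add (hh (t - s) 0 1)) fun u _ =>
    log_absSum_smul_le hΛ hc hst u

theorem exists_le_circleAverage_log_absSum_sub (hΛ : Λ.Nonempty) (hc : ∀ a ∈ Λ, c a ≠ 0) :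
    ∃ C ≥ 0, ∀ s t : ℝ, 0 < s → (t - s) * (semiperimeter (newtonPolygon Λ) / π) - C / s ≤
      circleAverage (fun z => log (absSum Λ c z)) 0 t -
        circleAverage (fun z => log (absSum Λ c z)) 0 s := by
  obtain ⟨C₁, hC₁, hray⟩ := exists_le_log_absSum_smul hΛ hc
  obtain ⟨C₂, hC₂, hpair⟩ := exists_circleAverage_pairSum_le Λ
  refine ⟨C₁ * C₂, by positivity, fun s t hs => ?_⟩
  have hS := circleIntegrable_log_absSum_smul hΛ hc
  have hh := circleIntegrable_mul_supportFun Λ (t - s) 0 1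
  have hpairInt : CircleIntegrable (fun u => C₁ * pairSum Λ (s • u)) 0 1 :=
    (((continuous_pairSum Λ).comp (continuous_const_smul s)).const_mul
      C₁).continuousOn.circleIntegrable'
  have hmean := circleAverage_mono ((hS s 0 1).add hh) ((hS t 0 1).add hpairInt)
    fun u _ => hray u s t hs.le
  have hpairMean : circleAverage (fun u => C₁ * pairSum Λ (s • u)) 0 1 ≤ C₁ * C₂ / s :=
    calc circleAverage (fun u => C₁ * pairSum Λ (s • u)) 0 1
        = C₁ * circleAverage (pairSum Λ) 0 s := by
          rw [circleAverage_zero_eq_circleAverage_smul _ s, circleAverage_const_mul]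
      _ ≤ C₁ * (C₂ / s) := by gcongr; exact hpair s hs
      _ = C₁ * C₂ / s := (mul_div_assoc _ _ _).symm
  rw [circleAverage_add (hS s 0 1) hh, circleAverage_add (hS t 0 1) hpairInt,
    circleAverage_const_mul, circleAverage_supportFun hΛ] at hmean
  rw [circleAverage_zero_eq_circleAverage_smul _ t, circleAverage_zero_eq_circleAverage_smul _ s]
  linarith

theorem circleAverage_deficit (hΛ : Λ.Nonempty) (hc : ∀ a ∈ Λ, c a ≠ 0) {t : ℝ} (ht : t ≠ 0) :
    circleAverage (deficit Λ c) 0 t = circleAverage (fun z => log (absSum Λ c z)) 0 t -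
      circleAverage (fun z => log ‖expSum Λ c z‖) 0 t :=
  circleAverage_log_div_norm (differentiable_expSum Λ c) (expSum_ne_zero hΛ hc)
    (continuous_absSum Λ c) (absSum_pos hΛ hc) 0 ht

theorem circleAverage_log_norm_expSum_le (hΛ : Λ.Nonempty) (hc : ∀ a ∈ Λ, c a ≠ 0) {t : ℝ}
    (ht : t ≠ 0) :
    circleAverage (fun z => log ‖expSum Λ c z‖) 0 t ≤
      circleAverage (fun z => log (absSum Λ c z)) 0 t := by
  rw [← sub_nonneg, ← circleAverage_deficit hΛ hc ht]
  exact circleAverage_nonneg_of_nonneg fun z _ => deficit_nonneg Λ c z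

end Growth

section ZeroCount

variable {Λ : Finset ℂ} {c : ℂ → ℂ}

theorem one_div_add_one_le_log_sub_log {t : ℝ} (ht : 0 < t) :
    1 / (t + 1) ≤ log (t + 1) - log t := by
  have := one_sub_inv_le_log_of_pos (x := (t + 1) / t) (by positivity)
  rw [log_div (by positivity) ht.ne'] at this
  refine le_trans (le_of_eq ?_) this
  field_simp
  ring

theorem log_add_one_sub_log_le {t : ℝ} (ht : 0 < t) : log (t + 1) - log t ≤ 1 / t := by
  have := log_le_sub_one_of_pos (x := (t + 1) / t) (by positivity)
  rw [log_div (by positivity) ht.ne'] at this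
  refine this.trans (le_of_eq ?_)
  field_simp
  ring

theorem zeroCount_expSum_le (hΛ : Λ.Nonempty) (hc : ∀ a ∈ Λ, c a ≠ 0) {C t : ℝ} (ht : 1 ≤ t)
    (hC : 0 ≤ C) (hdeficit : circleAverage (deficit Λ c) 0 t ≤ C / t) :
    zeroCount (expSum Λ c) t ≤ (t + 1) * (semiperimeter (newtonPolygon Λ) / π) + 2 * C := by
  have ht0 : 0 < t := one_pos.trans_le ht
  have hlog : (zeroCount (expSum Λ c) t : ℝ) * (1 / (t + 1)) ≤
      semiperimeter (newtonPolygon Λ) / π + C / t := by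
    have hjensen := zeroCount_mul_log_sub_log_le (differentiable_expSum Λ c)
      (expSum_ne_zero hΛ hc) ht0 (lt_add_one t).le
    have hstep := mul_le_mul_of_nonneg_left (one_div_add_one_le_log_sub_log ht0)
      (zeroCount (expSum Λ c) t).cast_nonneg
    have hgrowth := circleAverage_log_absSum_sub_le hΛ hc (lt_add_one t).le
    have hle := circleAverage_log_norm_expSum_le hΛ hc (by positivity : t + 1 ≠ 0)
    rw [circleAverage_deficit hΛ hc ht0.ne'] at hdeficit
    linarith
  rw [mul_one_div, div_le_iff₀ (by positivity)] at hlog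
  have herror : C / t * (t + 1) ≤ 2 * C := by
    rw [div_mul_eq_mul_div, div_le_iff₀ ht0]
    nlinarith
  linarith

theorem exists_le_zeroCount_expSum (hΛ : Λ.Nonempty) (hc : ∀ a ∈ Λ, c a ≠ 0) :
    ∃ C₀ ≥ 0, ∀ C t : ℝ, 0 < t → 0 ≤ C → circleAverage (deficit Λ c) 0 (t + 1) ≤ C / (t + 1) →
      t * (semiperimeter (newtonPolygon Λ) / π) - (C + C₀) ≤ zeroCount (expSum Λ c) (t + 1) := by
  obtain ⟨C₀, hC₀, hgrowth⟩ := exists_le_circleAverage_log_absSum_sub hΛ hc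
  refine ⟨C₀, hC₀, fun C t ht hC hdeficit => ?_⟩
  have hlog : semiperimeter (newtonPolygon Λ) / π - C / t - C₀ / t ≤
      zeroCount (expSum Λ c) (t + 1) * (1 / t) := by
    have hjensen := circleAverage_log_norm_sub_le (differentiable_expSum Λ c)
      (expSum_ne_zero hΛ hc) ht (lt_add_one t).le
    have hstep := mul_le_mul_of_nonneg_left (log_add_one_sub_log_le ht)
      (zeroCount (expSum Λ c) (t + 1)).cast_nonneg
    have hgrow := hgrowth t (t + 1) ht
    have hle := circleAverage_log_norm_expSum_le hΛ hc ht.ne'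
    have hCt : C / (t + 1) ≤ C / t := by gcongr; linarith
    rw [circleAverage_deficit hΛ hc (by positivity)] at hdeficit
    linarith
  rw [mul_one_div, le_div_iff₀ ht, sub_mul, sub_mul, div_mul_cancel₀ _ ht.ne',
    div_mul_cancel₀ _ ht.ne'] at hlog
  linarith

theorem exists_abs_zeroCount_expSum_sub_le (hΛ : Λ.Nonempty) (hc : ∀ a ∈ Λ, c a ≠ 0) :
    ∃ C, ∀ r ≥ 2, ∃ t ∈ Icc r (r + 1), |(zeroCount (expSum Λ c) t : ℝ) -
      t * (semiperimeter (newtonPolygon Λ) / π)| ≤ C := by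
  obtain ⟨C, hC, hradius⟩ := exists_circleAverage_deficit_le hΛ hc
  obtain ⟨C₀, hC₀, hlower⟩ := exists_le_zeroCount_expSum hΛ hc
  refine ⟨|semiperimeter (newtonPolygon Λ) / π| + 2 * C + C₀, fun r hr => ?_⟩
  obtain ⟨t, ht, hdeficit⟩ := hradius r (by linarith)
  have hupper := zeroCount_expSum_le hΛ hc (by linarith [ht.1]) hC hdeficit
  have hlower := hlower C (t - 1) (by linarith [ht.1]) hC (by rwa [sub_add_cancel])
  rw [sub_add_cancel] at hlower
  have habs := le_abs_self (semiperimeter (newtonPolygon Λ) / π)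
  refine ⟨t, ht, abs_le.2 ⟨?_, ?_⟩⟩ <;> linarith

theorem exists_abs_sub_mul_le_of_monotone {N : ℝ → ℝ} {l C r₀ : ℝ} (hN : Monotone N)
    (h : ∀ r ≥ r₀, ∃ t ∈ Icc r (r + 1), |N t - t * l| ≤ C) :
    ∃ C', ∀ r ≥ 0, |N r - r * l| ≤ C' := by
  have hshift : ∀ r t : ℝ, |t - r| ≤ 1 → |t * l - r * l| ≤ |l| := fun r t ht => by
    rw [← sub_mul, abs_mul]
    exact mul_le_of_le_one_left (abs_nonneg l) ht
  refine ⟨max (C + |l|) (|N 0| + |N (r₀ + 1)| + |r₀ + 1| * |l|), fun r hr => ?_⟩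
  rcases le_total r (r₀ + 1) with hr₀ | hr₀
  · refine le_max_of_le_right ?_
    have hrl : |r * l| ≤ |r₀ + 1| * |l| := by
      rw [abs_mul]
      gcongr
    have hNr : |N r| ≤ |N 0| + |N (r₀ + 1)| := abs_le_max_abs_abs (hN hr) (hN hr₀) |>.trans
      (max_le_add_of_nonneg (abs_nonneg _) (abs_nonneg _))
    exact (abs_sub _ _).trans (add_le_add hNr hrl)
  · refine le_max_of_le_left ?_
    obtain ⟨t, ⟨hrt, htr⟩, ht⟩ := h r (by linarith)
    obtain ⟨s, ⟨hrs, hsr⟩, hs⟩ := h (r - 1) (by linarith)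
    have hNt := hN hrt
    have hNs := hN (show s ≤ r by linarith)
    have htl := hshift r t (abs_le.2 ⟨by linarith, by linarith⟩)
    have hsl := hshift r s (abs_le.2 ⟨by linarith, by linarith⟩)
    rw [abs_le] at ht hs htl hsl ⊢
    constructor <;> linarith

end ZeroCount

end ExponentialSum

theorem theorem4 (Λ : Finset ℂ) (c : ℂ → ℂ) (hΛ : Λ.Nonempty) (hc : ∀ a ∈ Λ, c a ≠ 0) :
    (∀ r : ℝ, {z : ℂ | z ∈ Metric.closedBall (0 : ℂ) r ∧
      ExponentialSum.expSum Λ c z = 0}.Finite) ∧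
    ∃ C : ℝ, ∀ r : ℝ, 0 ≤ r →
      |(ExponentialSum.zeroCount (ExponentialSum.expSum Λ c) r : ℝ) -
        r / Real.pi * ExponentialSum.semiperimeter (ExponentialSum.newtonPolygon Λ)| ≤ C := by
  have hf := ExponentialSum.differentiable_expSum Λ c
  have hf0 := ExponentialSum.expSum_ne_zero hΛ hc
  refine ⟨ExponentialSum.finite_zeros hf hf0, ?_⟩
  have hmono : Monotone fun r => (ExponentialSum.zeroCount (ExponentialSum.expSum Λ c) r : ℝ) :=
    Nat.mono_cast.comp (ExponentialSum.zeroCount_mono hf hf0)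
  obtain ⟨C, hC⟩ := ExponentialSum.exists_abs_zeroCount_expSum_sub_le hΛ hc
  simp only [div_mul_eq_mul_div, mul_div_assoc]
  exact ExponentialSum.exists_abs_sub_mul_le_of_monotone hmono hC
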